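/- Let $p$ be a prime, $e\ge 1$ an integer, and $V$ an integral Noetherian scheme of characteristic $p$ that is $F$-finite and $F$-pure. Let $f\colon X\to V$ be a morphism of finite type and $L$ a line bundle on $X$. Write $R=\mathcal O_X$, $A=f^{-1}\mathcal O_V$, let $(-)^{1/p^k}=F^k_*(-)$ denote pushforward under the $k$-th iterate of the absolute Frobenius, put $V^{k}=V$ viewed as a $V$-scheme through $F^k\colon V\to V$, and $X_{V^{k}}=X\times_V V^{k}$, so that $\mathcal O_{X_{V^{k}}}=R_{A^{1/p^k}}:=R\otimes_A A^{1/p^k}$. Fix an $R_{A^{1/p^e}}$-linear map $\phi\colon L^{1/p^e}\to R_{A^{1/p^e}}$. *Iterates.* Define $\phi^n\colon \big(L^{\frac{p^{ne}-1}{p^e-1}}\big)^{1/p^{ne}}\to R_{A^{1/p^{ne}}}$ by letting $\phi^0$ be the identity of $R$ and $\phi^{n}$ the composition of $$(L\otimes_R\phi^{n-1})^{1/p^e}\colon \big(L^{\frac{p^{ne}-1}{p^e-1}}\big)^{1/p^{ne}}\to (L\otimes_R R_{A^{1/p^{(n-1)e}}})^{1/p^e}=L^{1/p^e}\otimes_{A^{1/p^e}}A^{1/p^{ne}}$$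 with $\phi\otimes_{A^{1/p^e}}A^{1/p^{ne}}$, and let $\sigma_n(X/V,\phi)\subseteq\mathcal O_{X_{V^{ne}}}$ be the image of $\phi^n$. For a scheme $Y$ of characteristic $p$, a line bundle $N$ on $Y$ and an $\mathcal O_Y$-linear map $\psi\colon F^e_*N\to\mathcal O_Y$, the iterates are $\psi^0=\mathrm{id}$ and $\psi^{n}=\psi\circ F^e_*(N\otimes\psi^{n-1})$, and the absolute non-$F$-pure ideal $\sigma(Y,\psi)$ is the intersection $\bigcap_n\operatorname{Im}(\psi^n)$ of the descending chain of their images (its stable value, when the chain stabilizes). *Perfect points.* A perfect point $u$ of $V$ is a morphism $\operatorname{Spec}K\to V$ with $K$ a perfect field. The base change $\phi_u$ of $\phi$ to $X_u=X\times_V u$, a map $L_u^{1/p^e}\to \mathcal O_{X_u}\otimes_K K^{1/p^e}$, is identified through $K^{1/p^e}\cong K$ with an absolute map $\psi_u\colon F^e_*L_u\to\mathcal O_{X_u}$. Let $\psi_\infty$ be this map for $K=k(V)^{1/p^\infty}$, the perfection of the function field of $V$, and let $n_0$ be an integer such that the images of the iterates satisfy $\operatorname{Im}(\psi_\infty^n)=\operatorname{Im}(\psi_\infty^{n_0})$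 for all $n\ge n_0$. *The induced absolute map.* Let $M$ be a line bundle on $V$ and $\Psi\colon F^e_*M\to\mathcal O_V$ an $\mathcal O_V$-linear map that generates $\mathcal Hom_{\mathcal O_V}(F^e_*M,\mathcal O_V)$ as an $F^e_*\mathcal O_V$-module (for instance $V$ quasi-Gorenstein and $M=\omega_V^{1-p^e}=\mathcal O_V((1-p^e)K_V)$ with its standard generator). For an integer $n$ put $N=L\otimes_A M^{1/p^{ne}}$, a line bundle on $X_{V^{ne}}$, and let $$\gamma\colon N^{1/p^e}=L^{1/p^e}\otimes_{A^{1/p^e}}M^{1/p^{(n+1)e}}\to R\otimes_A M^{1/p^{(n+1)e}}\to R\otimes_A A^{1/p^{ne}}=\mathcal O_{X_{V^{ne}}}$$ be the composition of $\phi\otimes_{A^{1/p^e}} M^{1/p^{(n+1)e}}$ and $R\otimes_A\Psi^{1/p^{ne}}$. **Theorem.** For every $n>n_0$ there is a dense open subset $U\subseteq V$ such that, with $W=f^{-1}(U)$, $$\sigma(X_{V^{ne}},\gamma)|_W=\sigma_n(X/V,\phi)|_W,$$ and such that for every perfect point $u\in U$ (that is, $\operatorname{Spec}K\to V$ with image in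 $U$) $$\sigma(X_{V^{ne}},\gamma)\cdot\mathcal O_{X_u}=\sigma_n(X_u/u,\phi_u)=\sigma(X_u,\psi_u),$$ where $X_{u^{ne}}=X\times_V \operatorname{Spec}K^{1/p^{ne}}$ is identified with $X_u$ through $K\cong K^{1/p^{ne}}$. -/

import Mathlib

open CategoryTheory AlgebraicGeometry TopologicalSpace
open scoped TensorProduct

universe u

noncomputable section

namespace RelFrob

set_option linter.unusedSectionVars false

/-! ### Rings of characteristic `p` and Frobenius pushforwards -/

/-- `A` is an algebra over `𝔽_p`, i.e. `p = 0` in `A` (the zero ring is allowed, since it may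
occur as the ring of functions of an empty fibre). -/
class InCharP (p : ℕ) (A : Type*) [CommRing A] : Prop where
  cast_eq_zero : (p : A) = 0

theorem add_pow_prime_pow {p : ℕ} [Fact p.Prime] {A : Type*} [CommRing A] [InCharP p A]
    (k : ℕ) (a b : A) : (a + b) ^ p ^ k = a ^ p ^ k + b ^ p ^ k := by
  rcases subsingleton_or_nontrivial A with h | h
  · exact Subsingleton.elim _ _
  · have : CharP A p := by
      have h1 := (CharP.cast_eq_zero_iff A (ringChar A) p).1 InCharP.cast_eq_zero
      rcases (Nat.dvd_prime (Fact.out : p.Prime)).1 h1 with h2 | h2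
      · exact absurd h2 (CharP.ringChar_ne_one)
      · exact h2 ▸ ringChar.charP A
    exact add_pow_char_pow a b p k

/-- The `k`-fold iterate of the Frobenius endomorphism, `a ↦ a ^ (p ^ k)`. -/
def iterFrob (p k : ℕ) [Fact p.Prime] (A : Type*) [CommRing A] [InCharP p A] : A →+* A where
  toFun a := a ^ p ^ k
  map_one' := one_pow _
  map_mul' a b := mul_pow a b _
  map_zero' := zero_pow (pow_ne_zero _ (Fact.out : p.Prime).ne_zero)
  map_add' := add_pow_prime_pow k

@[simp]
theorem iterFrob_apply (p k : ℕ) [Fact p.Prime] {A : Type*} [CommRing A] [InCharP p A] (a : A) :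
    iterFrob p k A a = a ^ p ^ k := rfl

instance {p : ℕ} {A R B : Type*} [CommRing A] [CommRing R] [CommRing B] [Algebra A R]
    [Algebra A B] [InCharP p R] : InCharP p (R ⊗[A] B) where
  cast_eq_zero := by
    have h := congrArg (algebraMap R (R ⊗[A] B)) (InCharP.cast_eq_zero (p := p) (A := R))
    simpa using h

instance (priority := 50) {p : ℕ} {A : Type*} [CommRing A] [CharP A p] : InCharP p A where
  cast_eq_zero := CharP.cast_eq_zero A p

/-- The Frobenius pushforward `P^{1/p^k} = F^k_* P` of a module: the group `P`, on which a ring `A`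
acting on `P` acts through `a ↦ a ^ (p ^ k)`. -/
def Frob (_p _k : ℕ) (P : Type*) : Type _ := P

/-- The identity map `P → F^k_* P`, `x ↦ x^{1/p^k}`. -/
def toFrob (p k : ℕ) {P : Type*} (x : P) : Frob p k P := x

/-- The identity map `F^k_* P → P`. -/
def ofFrob {p k : ℕ} {P : Type*} (x : Frob p k P) : P := x

/-- The ring `A^{1/p^k} = F^k_* A`: the ring `A`, regarded as an `A`-algebra through
`a ↦ a ^ (p ^ k)`. -/
def Root (_p _k : ℕ) (A : Type*) : Type _ := A

/-- The identity map `A → A^{1/p^k}`, `a ↦ a^{1/p^k}`. -/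
def toRoot (p k : ℕ) {A : Type*} (a : A) : Root p k A := a

/-- The identity map `A^{1/p^k} → A`. -/
def ofRoot {p k : ℕ} {A : Type*} (a : Root p k A) : A := a

section FrobInstances

variable (p k : ℕ)

instance (P : Type*) [AddCommGroup P] : AddCommGroup (Frob p k P) := inferInstanceAs (AddCommGroup P)

instance (B : Type*) [CommRing B] : CommRing (Root p k B) := inferInstanceAs (CommRing B)

/-- `P^{1/p^k}` is a module over the ring `B^{1/p^k}` when `P` is a `B`-module. -/
instance (B P : Type*) [CommRing B] [AddCommGroup P] [Module B P] :
    Module (Root p k B) (Frob p k P) :=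
  inferInstanceAs (Module B P)

/-- A ring homomorphism `A → B` regarded as a homomorphism `A^{1/p^k} → B^{1/p^k}`. -/
def rootMap {A B : Type*} [CommRing A] [CommRing B] (g : A →+* B) : Root p k A →+* Root p k B := g

variable [Fact p.Prime]

instance (A P : Type*) [CommRing A] [InCharP p A] [AddCommGroup P] [Module A P] :
    Module A (Frob p k P) :=
  Module.compHom P (iterFrob p k A)

instance (A B : Type*) [CommRing A] [InCharP p A] [CommRing B] [Algebra A B] :
    Algebra A (Root p k B) :=
  RingHom.toAlgebra (S := Root p k B) ((algebraMap A B).comp (iterFrob p k A))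

instance (A P : Type*) [CommRing A] [InCharP p A] [AddCommGroup P] [Module A P] :
    IsScalarTower A (Root p k A) (Frob p k P) where
  smul_assoc a b x := mul_smul (α := A) (β := P) (a ^ p ^ k) b x

/-- `(A^{1/p^k})^{1/p^e} = A^{1/p^{k+e}}`. -/
def frobRoot (e : ℕ) (A : Type*) [CommRing A] [InCharP p A] :
    Frob p e (Root p k A) →ₗ[A] Root p (k + e) A where
  toFun x := toRoot p (k + e) (ofRoot (ofFrob x))
  map_add' _ _ := rfl
  map_smul' a x := by
    have h : ((a ^ p ^ e) ^ p ^ k : A) = a ^ p ^ (k + e) := by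
      rw [← pow_mul, ← pow_add, add_comm e k]
    exact congrArg (fun b : A => b * (ofRoot (ofFrob x))) h

end FrobInstances

/-! ### External tensor products -/

/-- For an `S`-module `P` and an `S'`-module `P'`, the group `P ⊗[A] P'` regarded as a module over
`S ⊗[A] S'`, by `(s ⊗ s') • (x ⊗ x') = (s • x) ⊗ (s' • x')`. -/
def ExtTensor (A S S' P P' : Type*) [CommRing A] [CommRing S] [CommRing S'] [AddCommGroup P]
    [AddCommGroup P'] [Algebra A S] [Algebra A S'] [Module A P] [Module A P']
    [Module S P] [Module S' P'] [IsScalarTower A S P] [IsScalarTower A S' P'] : Type _ :=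
  P ⊗[A] P'

section ExtTensor

variable (A S S' P P' : Type*) [CommRing A] [CommRing S] [CommRing S'] [AddCommGroup P]
    [AddCommGroup P'] [Algebra A S] [Algebra A S'] [Module A P] [Module A P']
    [Module S P] [Module S' P'] [IsScalarTower A S P] [IsScalarTower A S' P']

instance : AddCommGroup (ExtTensor A S S' P P') := inferInstanceAs (AddCommGroup (P ⊗[A] P'))

/-- The action of `S ⊗[A] S'` on `P ⊗[A] P'`. -/
def extAction : S ⊗[A] S' →ₐ[A] Module.End A (P ⊗[A] P') :=
  (Module.endTensorEndAlgHom (R := A) (S := A) (A := A) (M := P) (N := P')).comp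
    (Algebra.TensorProduct.map (Algebra.lsmul A A P) (Algebra.lsmul A A P'))

instance : Module (S ⊗[A] S') (ExtTensor A S S' P P') :=
  Module.compHom (P ⊗[A] P') (extAction A S S' P P').toRingHom

instance : Module S (ExtTensor A S S' P P') :=
  Module.compHom (ExtTensor A S S' P P') (algebraMap S (S ⊗[A] S'))

instance : IsScalarTower S (S ⊗[A] S') (ExtTensor A S S' P P') where
  smul_assoc s t x := by
    rw [Algebra.smul_def, mul_smul]
    rfl

variable {A S S' P P'}

/-- The pure tensor `x ⊗ x'`. -/
def extTmul (x : P) (x' : P') : ExtTensor A S S' P P' := x ⊗ₜ[A] x'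

theorem smul_extTmul (s : S) (s' : S') (x : P) (x' : P') :
    (s ⊗ₜ[A] s') • (extTmul x x' : ExtTensor A S S' P P') = extTmul (s • x) (s' • x') := rfl

theorem ext_induction {motive : ExtTensor A S S' P P' → Prop} (x : ExtTensor A S S' P P')
    (h0 : motive 0) (ht : ∀ y y', motive (extTmul y y'))
    (ha : ∀ y y', motive y → motive y' → motive (y + y')) : motive x :=
  TensorProduct.induction_on (motive := motive) x h0 ht ha

end ExtTensor

/-! ### `p^{-e}`-linear maps and their iterates -/

/-- An `S`-linear map `N^{1/p^e} = F^e_* N → S`, i.e. an additive map `N → S` with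
`ψ (s ^ (p ^ e) • x) = s * ψ x`. -/
structure CartierMap (p e : ℕ) (S N : Type*) [CommRing S] [AddCommGroup N] [Module S N]
    extends N →+ S where
  map_smul' : ∀ (s : S) (x : N), toFun (s ^ p ^ e • x) = s * toFun x

/-- The source of the `n`-th iterate, as an `R`-module: it is `R` for `n = 0`, and
`(L ⊗_R D_n)^{1/p^e}` for `n + 1`. For invertible `L` this is canonically
`(L^{(p^{ne} - 1)/(p^e - 1)})^{1/p^{ne}}`. -/
def iterSource (p e : ℕ) [Fact p.Prime] (R L : Type u) [CommRing R] [InCharP p R]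
    [AddCommGroup L] [Module R L] : ℕ → ModuleCat.{u} R
  | 0 => ModuleCat.of R R
  | n + 1 => ModuleCat.of R (Frob p e (L ⊗[R] iterSource p e R L n))

namespace CartierMap

variable {p e : ℕ} [Fact p.Prime] {S N : Type u} [CommRing S] [InCharP p S] [AddCommGroup N]
  [Module S N]

/-- The composition `(N ⊗_S D)^{1/p^e} → (N ⊗_S S)^{1/p^e} = N^{1/p^e} → S` of `(N ⊗ g)^{1/p^e}`
and `ψ`, for an `S`-linear map `g : D → S`. -/
def step (ψ : CartierMap p e S N) {D : Type u} [AddCommGroup D] [Module S D] (g : D →ₗ[S] S) :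
    Frob p e (N ⊗[S] D) →ₗ[S] S where
  toFun x := ψ.toAddMonoidHom (TensorProduct.rid S N (g.lTensor N (ofFrob x)))
  map_add' x y := by
    have h : ofFrob (x + y) = ofFrob x + ofFrob y := rfl
    simp only [h, map_add]
  map_smul' s x := by
    have h : ofFrob (s • x) = s ^ p ^ e • ofFrob x := rfl
    rw [h, map_smul, map_smul]
    exact ψ.map_smul' _ _

/-- The `n`-th iterate `ψ^n : (N^{(p^{ne} - 1)/(p^e - 1)})^{1/p^{ne}} → S`; `ψ^{n+1}` is the
composition of `(N ⊗ ψ^n)^{1/p^e}` and `ψ`. -/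
def iter (ψ : CartierMap p e S N) : (n : ℕ) → iterSource p e S N n →ₗ[S] S
  | 0 => (LinearMap.id : S →ₗ[S] S)
  | n + 1 => ψ.step (iter ψ n)

/-- The image of `ψ^n`, an ideal of `S`. -/
def image (ψ : CartierMap p e S N) (n : ℕ) : Ideal S := LinearMap.range (ψ.iter n)

/-- The absolute non-`F`-pure ideal `σ(S, ψ)`: the intersection of the descending chain of the
images of the iterates of `ψ`; it is the stable value of the chain when the chain stabilizes. -/
def sigma (ψ : CartierMap p e S N) : Ideal S := ⨅ n, ψ.image n

end CartierMap

/-! ### Relative `p^{-e}`-linear maps, on affine charts -/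

/-- For an `A`-algebra `R`, an `R ⊗_A A^{1/p^e}`-linear map `L^{1/p^e} → R ⊗_A A^{1/p^e}`; the
element `r ⊗ a^{1/p^e}` acts on `L^{1/p^e}` through the relative Frobenius, that is, as
multiplication by `r ^ (p ^ e) * a` on `L`. -/
structure RelCartierMap (p e : ℕ) [Fact p.Prime] (A R L : Type*) [CommRing A] [InCharP p A]
    [CommRing R] [Algebra A R] [AddCommGroup L] [Module A L] [Module R L]
    extends L →+ R ⊗[A] Root p e A where
  map_smul' : ∀ (r : R) (a : A) (l : L),
    toFun (r ^ p ^ e • a • l) = (r ⊗ₜ[A] toRoot p e a) * toFun l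

/-- For a commutative square of ring homomorphisms from `A → R` to `A' → R'`, the induced ring
homomorphism `R ⊗_A A^{1/p^k} → R' ⊗_{A'} A'^{1/p^k}`. -/
def relRingMap (p k : ℕ) [Fact p.Prime] {A R A' R' : Type*} [CommRing A] [InCharP p A]
    [CommRing R] [Algebra A R] [CommRing A'] [InCharP p A'] [CommRing R'] [Algebra A' R']
    (g : A →+* A') (h : R →+* R') (hgh : h.comp (algebraMap A R) = (algebraMap A' R').comp g) :
    R ⊗[A] Root p k A →+* R' ⊗[A'] Root p k A' :=
  Algebra.TensorProduct.mapRingHom g h (rootMap p k g) hgh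
    (RingHom.ext fun a => map_pow g a (p ^ k))

/-- For an `A`-algebra `B` and `R_B = B ⊗_A R`, the ring homomorphism
`R ⊗_A A^{1/p^k} → R ⊗_A B^{1/p^k} = R_B ⊗_B B^{1/p^k}`. -/
def baseRingMap (p k : ℕ) [Fact p.Prime] (A R B : Type*) [CommRing A] [InCharP p A]
    [CommRing R] [Algebra A R] [CommRing B] [InCharP p B] [Algebra A B] :
    R ⊗[A] Root p k A →+* (B ⊗[A] R) ⊗[B] Root p k B :=
  relRingMap p k (algebraMap A B) (Algebra.TensorProduct.includeRight : R →ₐ[A] B ⊗[A] R).toRingHom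
    (RingHom.ext fun a => by
      simp)

namespace RelCartierMap

variable {p e : ℕ} [Fact p.Prime] {A R L : Type u} [CommRing A] [InCharP p A]
    [CommRing R] [InCharP p R] [Algebra A R] [AddCommGroup L] [Module A L] [Module R L]
    [IsScalarTower A R L]

/-- For `x ∈ P`, the map `R ⊗_A A^{1/p^e} → R ⊗_A P^{1/p^e}` given by
`r ⊗ a^{1/p^e} ↦ r ⊗ (a x)^{1/p^e}`. -/
def actOn (p e : ℕ) [Fact p.Prime] (A R : Type*) [CommRing A] [InCharP p A] [CommRing R]
    [Algebra A R] {P : Type*} [AddCommGroup P] [Module A P] (x : P) :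
    R ⊗[A] Root p e A →ₗ[R] R ⊗[A] Frob p e P :=
  LinearMap.baseChange R
    (((LinearMap.toSpanSingleton (Root p e A) (Frob p e P) (toFrob p e x)).restrictScalars A))

@[simp]
theorem actOn_tmul {P : Type*} [AddCommGroup P] [Module A P] (x : P) (r : R) (a : A) :
    actOn p e A R x (r ⊗ₜ toRoot p e a) = r ⊗ₜ toFrob p e (a • x) := rfl

theorem actOn_add {P : Type*} [AddCommGroup P] [Module A P] (x y : P)
    (t : R ⊗[A] Root p e A) : actOn p e A R (x + y) t = actOn p e A R x t + actOn p e A R y t := by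
  induction t with
  | zero => simp
  | add t t' h h' => rw [map_add, map_add, map_add, h, h']; abel
  | tmul r a =>
    change actOn p e A R (x + y) (r ⊗ₜ toRoot p e (ofRoot a)) =
      actOn p e A R x (r ⊗ₜ toRoot p e (ofRoot a)) + actOn p e A R y (r ⊗ₜ toRoot p e (ofRoot a))
    rw [actOn_tmul, actOn_tmul, actOn_tmul, smul_add, ← TensorProduct.tmul_add]
    rfl

theorem actOn_one_tmul_mul {P : Type*} [AddCommGroup P] [Module A P] (a : A) (x : P)
    (t : R ⊗[A] Root p e A) :
    actOn p e A R x (((1 : R) ⊗ₜ toRoot p e a) * t) = actOn p e A R (a • x) t := by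
  induction t with
  | zero => simp
  | add t t' h h' => rw [mul_add, map_add, map_add, h, h']
  | tmul r b =>
    rw [Algebra.TensorProduct.tmul_mul_tmul, one_mul]
    change actOn p e A R x (r ⊗ₜ toRoot p e (a * ofRoot b)) =
      actOn p e A R (a • x) (r ⊗ₜ toRoot p e (ofRoot b))
    rw [actOn_tmul, actOn_tmul, mul_comm, mul_smul]

/-- `actOn` as a biadditive map. -/
def actHom (p e : ℕ) [Fact p.Prime] (A R P : Type u) [CommRing A] [InCharP p A] [CommRing R]
    [InCharP p R] [Algebra A R] [AddCommGroup P] [Module A P] :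
    P →+ R ⊗[A] Root p e A →+ R ⊗[A] Frob p e P :=
  AddMonoidHom.mk' (fun x => (actOn p e A R x).toAddMonoidHom)
    (fun x y => AddMonoidHom.ext fun t => actOn_add x y t)

/-- The map `φ ⊗_{A^{1/p^e}} P^{1/p^e}`, from
`(L ⊗_A P)^{1/p^e} = L^{1/p^e} ⊗_{A^{1/p^e}} P^{1/p^e}` to
`(R ⊗_A A^{1/p^e}) ⊗_{A^{1/p^e}} P^{1/p^e} = R ⊗_A P^{1/p^e}`, for an `A`-module `P`: it sends
`l ⊗ x` to `φ(l) · x`. -/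
def twist (φ : RelCartierMap p e A R L) (P : Type u) [AddCommGroup P] [Module A P] :
    L ⊗[A] P →+ R ⊗[A] Frob p e P :=
  TensorProduct.liftAddHom ((actHom p e A R P).flip.comp φ.toAddMonoidHom) (fun a l x => by
    have h := φ.map_smul' 1 a l
    rw [one_pow, one_smul] at h
    change actOn p e A R x (φ.toFun (a • l)) = actOn p e A R (a • x) (φ.toFun l)
    rw [h]
    exact actOn_one_tmul_mul a x _)

@[simp]
theorem twist_tmul (φ : RelCartierMap p e A R L) {P : Type u} [AddCommGroup P] [Module A P]
    (l : L) (x : P) : φ.twist P (l ⊗ₜ x) = actOn p e A R x (φ.toAddMonoidHom l) := rfl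

theorem twist_pow_smul (φ : RelCartierMap p e A R L) {P : Type u} [AddCommGroup P] [Module A P]
    (r : R) (t : L ⊗[A] P) : φ.twist P (r ^ p ^ e • t) = r • φ.twist P t := by
  induction t with
  | zero => simp
  | add x y hx hy => rw [smul_add, map_add, hx, hy, map_add, smul_add]
  | tmul l x =>
    have h := φ.map_smul' r 1 l
    rw [one_smul] at h
    rw [TensorProduct.smul_tmul', twist_tmul, twist_tmul]
    change actOn p e A R x (φ.toFun _) = _
    rw [h, ← map_smul, Algebra.smul_def]
    rfl

/-- The composition
`(L ⊗_R D)^{1/p^e} → (L ⊗_R (R ⊗_A A^{1/p^k}))^{1/p^e} = L^{1/p^e} ⊗_{A^{1/p^e}} A^{1/p^{k+e}}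
→ R ⊗_A A^{1/p^{k+e}}` of `(L ⊗ g)^{1/p^e}` and `φ ⊗_{A^{1/p^e}} A^{1/p^{k+e}}`, for an `R`-linear
map `g : D → R ⊗_A A^{1/p^k}`. -/
def step (φ : RelCartierMap p e A R L) (k : ℕ) {D : Type u} [AddCommGroup D] [Module R D]
    (g : D →ₗ[R] R ⊗[A] Root p k A) :
    Frob p e (L ⊗[R] D) →ₗ[R] R ⊗[A] Root p (k + e) A where
  toFun x := LinearMap.baseChange R (frobRoot p k e A) (φ.twist (Root p k A)
    (TensorProduct.AlgebraTensorModule.cancelBaseChange A R R L (Root p k A)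
      (g.lTensor L (ofFrob x))))
  map_add' x y := by
    have h : ofFrob (x + y) = ofFrob x + ofFrob y := rfl
    simp only [h, map_add]
  map_smul' r x := by
    have h : ofFrob (r • x) = r ^ p ^ e • ofFrob x := rfl
    rw [h, map_smul, map_smul, twist_pow_smul, map_smul]
    rfl

/-- The `n`-th iterate
`φ^n : (L^{(p^{ne} - 1)/(p^e - 1)})^{1/p^{ne}} → R ⊗_A A^{1/p^{ne}}`; `φ^{n+1}` is the composition
of `(L ⊗ φ^n)^{1/p^e}` and `φ ⊗_{A^{1/p^e}} A^{1/p^{(n+1)e}}`. -/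
def iter (φ : RelCartierMap p e A R L) :
    (n : ℕ) → iterSource p e R L n →ₗ[R] R ⊗[A] Root p (e * n) A
  | 0 => (Algebra.linearMap R (R ⊗[A] Root p (e * 0) A) : R →ₗ[R] _)
  | n + 1 => φ.step (e * n) (iter φ n)

/-- The `n`-th relative non-`F`-pure ideal `σ_n` of `R ⊗_A A^{1/p^{ne}}`: the image of `φ^n`
(which is already closed under multiplication by `A^{1/p^{ne}}`). -/
def image (φ : RelCartierMap p e A R L) (n : ℕ) : Ideal (R ⊗[A] Root p (e * n) A) :=
  Ideal.span (Set.range (φ.iter n))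

/-! #### The induced absolute map `γ` -/

/-- For `Ψ : M^{1/p^e} → A`, the map `Ψ^{1/p^k} : M^{1/p^{k+e}} → A^{1/p^k}`. -/
def rootOf {M : Type u} [AddCommGroup M] [Module A M] (Ψ : CartierMap p e A M) (k : ℕ) :
    Frob p e (Frob p k M) →ₗ[A] Root p k A where
  toFun x := toRoot p k (Ψ.toAddMonoidHom (ofFrob (ofFrob x)))
  map_add' x y := Ψ.toAddMonoidHom.map_add (ofFrob (ofFrob x)) (ofFrob (ofFrob y))
  map_smul' a x := by
    have h := Ψ.map_smul' (a ^ p ^ k) (ofFrob (ofFrob x))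
    have h2 : ((a ^ p ^ k) ^ p ^ e : A) = (a ^ p ^ e) ^ p ^ k := by
      rw [← pow_mul, ← pow_mul, mul_comm]
    rw [h2] at h
    exact h

/-- The line bundle `N = L ⊗_A M^{1/p^{ne}}` over `R ⊗_A A^{1/p^{ne}}`. -/
abbrev GammaSource (p e : ℕ) [Fact p.Prime] (A R L M : Type u) [CommRing A] [InCharP p A]
    [CommRing R] [Algebra A R] [AddCommGroup L] [Module A L] [Module R L]
    [IsScalarTower A R L] [AddCommGroup M] [Module A M] (n : ℕ) : Type u :=
  ExtTensor A R (Root p (e * n) A) L (Frob p (e * n) M)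

/-- The additive map underlying `γ`. -/
def gammaAux {M : Type u} [AddCommGroup M] [Module A M] (φ : RelCartierMap p e A R L)
    (Ψ : CartierMap p e A M) (n : ℕ) :
    GammaSource p e A R L M n →+ R ⊗[A] Root p (e * n) A :=
  (LinearMap.baseChange R (rootOf Ψ (e * n))).toAddMonoidHom.comp (φ.twist (Frob p (e * n) M))

theorem baseChange_rootOf_actOn {M : Type u} [AddCommGroup M] [Module A M]
    (Ψ : CartierMap p e A M) (k : ℕ) (b : Root p k A) (m : Frob p k M)
    (t : R ⊗[A] Root p e A) :
    LinearMap.baseChange R (rootOf Ψ k) (actOn p e A R (b ^ p ^ e • m) t) =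
      ((1 : R) ⊗ₜ b) * LinearMap.baseChange R (rootOf Ψ k) (actOn p e A R m t) := by
  induction t with
  | zero => simp
  | add t t' h h' => rw [map_add, map_add, h, h', map_add, map_add, mul_add]
  | tmul r a =>
    change r ⊗ₜ rootOf Ψ k (toFrob p e (ofRoot a • (b ^ p ^ e • m))) =
      ((1 : R) ⊗ₜ b) * (r ⊗ₜ rootOf Ψ k (toFrob p e (ofRoot a • m)))
    rw [Algebra.TensorProduct.tmul_mul_tmul, one_mul]
    congr 1
    have h := Ψ.map_smul' (ofRoot b) ((ofRoot a ^ p ^ k : A) • (ofFrob m : M))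
    rw [smul_comm] at h
    exact h

theorem gammaAux_smul {M : Type u} [AddCommGroup M] [Module A M] (φ : RelCartierMap p e A R L)
    (Ψ : CartierMap p e A M) (n : ℕ) (s : R ⊗[A] Root p (e * n) A)
    (x : GammaSource p e A R L M n) :
    gammaAux φ Ψ n (s ^ p ^ e • x) = s * gammaAux φ Ψ n x := by
  induction x using ext_induction with
  | h0 => rw [smul_zero, map_zero, mul_zero]
  | ha x y hx hy => rw [smul_add, map_add, hx, hy, map_add, mul_add]
  | ht l m =>
    induction s with
    | zero =>
      rw [zero_pow (pow_ne_zero _ (Fact.out : p.Prime).ne_zero), zero_smul, map_zero, zero_mul]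
    | add s t hs ht => rw [add_pow_prime_pow, add_smul, map_add, hs, ht, add_mul]
    | tmul r b =>
      rw [Algebra.TensorProduct.tmul_pow, smul_extTmul]
      have h := φ.map_smul' r 1 l
      rw [one_smul] at h
      change LinearMap.baseChange R (rootOf Ψ (e * n)) (actOn p e A R (b ^ p ^ e • m)
        (φ.toFun (r ^ p ^ e • l))) = (r ⊗ₜ b) *
          LinearMap.baseChange R (rootOf Ψ (e * n)) (actOn p e A R m (φ.toFun l))
      rw [h, baseChange_rootOf_actOn]
      have h2 : (r ⊗ₜ[A] toRoot p e (1 : A)) * φ.toFun l = r • φ.toFun l := by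
        rw [Algebra.smul_def]; rfl
      have h3 : (r ⊗ₜ[A] b) = ((1 : R) ⊗ₜ[A] b) * algebraMap R (R ⊗[A] Root p (e * n) A) r := by
        rw [Algebra.TensorProduct.algebraMap_apply, Algebra.TensorProduct.tmul_mul_tmul]
        simp
      rw [h2, map_smul, map_smul, h3, mul_assoc, ← Algebra.smul_def]

/-- The map `γ : N^{1/p^e} = L^{1/p^e} ⊗_{A^{1/p^e}} M^{1/p^{(n+1)e}} → R ⊗_A A^{1/p^{ne}}`, the
composition of `φ ⊗ M^{1/p^{(n+1)e}}` (with values in `R ⊗_A M^{1/p^{(n+1)e}}`) and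
`R ⊗_A Ψ^{1/p^{ne}}`. -/
def gamma {M : Type u} [AddCommGroup M] [Module A M] (φ : RelCartierMap p e A R L)
    (Ψ : CartierMap p e A M) (n : ℕ) :
    CartierMap p e (R ⊗[A] Root p (e * n) A) (GammaSource p e A R L M n) where
  toAddMonoidHom := gammaAux φ Ψ n
  map_smul' s x := gammaAux_smul φ Ψ n s x

/-! #### Base change and fibres -/

theorem one_tmul_mul_baseRingMap (B : Type u) [CommRing B] [InCharP p B] [Algebra A B] (a : A)
    (t : R ⊗[A] Root p e A) :
    baseRingMap p e A R B (((1 : R) ⊗ₜ toRoot p e a) * t) =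
      ((1 : B ⊗[A] R) ⊗ₜ[B] toRoot p e (algebraMap A B a)) * baseRingMap p e A R B t := by
  rw [map_mul]
  congr 1
  simp only [baseRingMap, relRingMap, Algebra.TensorProduct.mapRingHom_tmul, map_one]
  rfl

/-- The biadditive map `(b, l) ↦ b^{1/p^e} · φ(l)`. -/
def baseChangeAux (φ : RelCartierMap p e A R L) (B : Type u) [CommRing B] [InCharP p B]
    [Algebra A B] : B →+ L →+ (B ⊗[A] R) ⊗[B] Root p e B :=
  (AddMonoidHom.mul.comp (AddMonoidHom.mk' (fun b => (1 : B ⊗[A] R) ⊗ₜ[B] toRoot p e b)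
    (fun b b' => TensorProduct.tmul_add _ (toRoot p e b) (toRoot p e b')))).compl₂
    ((baseRingMap p e A R B).toAddMonoidHom.comp φ.toAddMonoidHom)

/-- The additive map underlying `φ_B`. -/
def baseChangeHom (φ : RelCartierMap p e A R L) (B : Type u) [CommRing B] [InCharP p B]
    [Algebra A B] : ExtTensor A B R B L →+ (B ⊗[A] R) ⊗[B] Root p e B :=
  TensorProduct.liftAddHom (R := A) (baseChangeAux φ B) (fun a b l => by
    have h := φ.map_smul' 1 a l
    rw [one_pow, one_smul] at h
    change ((1 : B ⊗[A] R) ⊗ₜ[B] toRoot p e (a • b)) * baseRingMap p e A R B (φ.toFun l) =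
      ((1 : B ⊗[A] R) ⊗ₜ[B] toRoot p e b) * baseRingMap p e A R B (φ.toFun (a • l))
    rw [h, one_tmul_mul_baseRingMap, ← mul_assoc, Algebra.TensorProduct.tmul_mul_tmul, one_mul]
    congr 2
    rw [Algebra.smul_def, mul_comm]
    rfl)

theorem baseChangeHom_extTmul (φ : RelCartierMap p e A R L) (B : Type u) [CommRing B]
    [InCharP p B] [Algebra A B] (b : B) (l : L) :
    baseChangeHom φ B (extTmul b l) =
      ((1 : B ⊗[A] R) ⊗ₜ[B] toRoot p e b) * baseRingMap p e A R B (φ.toFun l) := rfl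

theorem baseChangeHom_smul (φ : RelCartierMap p e A R L) (B : Type u) [CommRing B] [InCharP p B]
    [Algebra A B] (r : B ⊗[A] R) (b : B) (x : ExtTensor A B R B L) :
    baseChangeHom φ B (r ^ p ^ e • b • x) = (r ⊗ₜ[B] toRoot p e b) * baseChangeHom φ B x := by
  induction x using ext_induction with
  | h0 => rw [smul_zero, smul_zero, map_zero, mul_zero]
  | ha x y hx hy => rw [smul_add, smul_add, map_add, hx, hy, map_add, mul_add]
  | ht b' l =>
    induction r with
    | zero =>
      rw [zero_pow (pow_ne_zero _ (Fact.out : p.Prime).ne_zero), zero_smul, map_zero,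
        TensorProduct.zero_tmul, zero_mul]
    | add s t hs ht =>
      rw [add_pow_prime_pow, add_smul, map_add, hs, ht, TensorProduct.add_tmul, add_mul]
    | tmul c r =>
      have h1 : b • (extTmul b' l : ExtTensor A B R B L) = extTmul (b * b') l := by
        change (b ⊗ₜ[A] (1 : R)) • (extTmul b' l : ExtTensor A B R B L) = _
        rw [smul_extTmul, one_smul, smul_eq_mul]
      have h := φ.map_smul' r 1 l
      rw [one_smul] at h
      rw [h1, Algebra.TensorProduct.tmul_pow, smul_extTmul, baseChangeHom_extTmul,
        baseChangeHom_extTmul, h, map_mul, ← mul_assoc, ← mul_assoc]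
      congr 1
      have h3 : baseRingMap p e A R B (r ⊗ₜ toRoot p e (1 : A)) =
          ((1 : B) ⊗ₜ[A] r) ⊗ₜ[B] (1 : Root p e B) := by
        simp only [baseRingMap, relRingMap, Algebra.TensorProduct.mapRingHom_tmul]
        congr 1
        exact map_one (algebraMap A B)
      have h4 : (c ⊗ₜ[A] r) = c • ((1 : B) ⊗ₜ[A] r) := by
        rw [TensorProduct.smul_tmul', smul_eq_mul, mul_one]
      rw [h3, h4, Algebra.TensorProduct.tmul_mul_tmul, Algebra.TensorProduct.tmul_mul_tmul, one_mul,
        mul_one, mul_one, TensorProduct.smul_tmul]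
      rfl

/-- The base change `φ_B : L_B^{1/p^e} = L^{1/p^e} ⊗_{A^{1/p^e}} B^{1/p^e} → R_B ⊗_B B^{1/p^e}` of
`φ` along `A → B`, where `R_B = B ⊗_A R` and `L_B = B ⊗_A L`; it sends `b ⊗ l` to
`b^{1/p^e} · φ(l)`. -/
def baseChange (φ : RelCartierMap p e A R L) (B : Type u) [CommRing B] [InCharP p B]
    [Algebra A B] : RelCartierMap p e B (B ⊗[A] R) (ExtTensor A B R B L) where
  toAddMonoidHom := baseChangeHom φ B
  map_smul' r b x := baseChangeHom_smul φ B r b x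

/-- For a perfect field `K`, the isomorphism `K^{1/p^e} → K`, `x^{1/p^e} ↦ x^{1/p^e}`. -/
def perfectRoot (p e : ℕ) [Fact p.Prime] (K : Type u) [Field K] [CharP K p] [PerfectRing K p] :
    Root p e K →ₗ[K] K where
  toFun x := (iterateFrobeniusEquiv K p e).symm (ofRoot x)
  map_add' x y := map_add (iterateFrobeniusEquiv K p e).symm (ofRoot x) (ofRoot y)
  map_smul' a x := by
    change (iterateFrobeniusEquiv K p e).symm (a ^ p ^ e * ofRoot x) =
      a * (iterateFrobeniusEquiv K p e).symm (ofRoot x)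
    rw [map_mul]
    congr 1
    exact (iterateFrobeniusEquiv K p e).symm_apply_apply a

/-- Over a perfect field `K`, a relative map `φ : L^{1/p^e} → R ⊗_K K^{1/p^e} ≅ R` viewed as an
absolute `p^{-e}`-linear map `ψ : L^{1/p^e} → R`. -/
def toAbsolute {K R L : Type u} [Field K] [CharP K p] [PerfectRing K p] [CommRing R] [Algebra K R]
    [AddCommGroup L] [Module K L] [Module R L] [IsScalarTower K R L]
    (φ : RelCartierMap p e K R L) : CartierMap p e R L where
  toAddMonoidHom := ((TensorProduct.AlgebraTensorModule.rid K R R).toLinearMap ∘ₗ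
    LinearMap.baseChange R (perfectRoot p e K)).toAddMonoidHom.comp φ.toAddMonoidHom
  map_smul' s x := by
    have h := φ.map_smul' s 1 x
    rw [one_smul] at h
    have h2 : (s ⊗ₜ[K] toRoot p e (1 : K)) * φ.toFun x = s • φ.toFun x := by
      rw [Algebra.smul_def]; rfl
    rw [h2] at h
    change ((TensorProduct.AlgebraTensorModule.rid K R R).toLinearMap ∘ₗ
      LinearMap.baseChange R (perfectRoot p e K)) (φ.toFun (s ^ p ^ e • x)) = s • _
    rw [h, map_smul]
    rfl

/-- The map `ψ_u : L_K^{1/p^e} → R_K` on the fibre over a perfect field `K`: the base change `φ_K`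
viewed as an absolute `p^{-e}`-linear map. -/
def fiberMap (φ : RelCartierMap p e A R L) (K : Type u) [Field K] [CharP K p] [PerfectRing K p]
    [Algebra A K] : CartierMap p e (K ⊗[A] R) (ExtTensor A K R K L) :=
  (φ.baseChange K).toAbsolute

end RelCartierMap

/-! ### Schemes -/

/-- `V` is a scheme of characteristic `p`, i.e. `p = 0` in `𝒪_V`. -/
class SchemeCharP (p : ℕ) (V : Scheme.{u}) : Prop where
  cast_eq_zero : (p : Γ(V, ⊤)) = 0

instance (p : ℕ) (V : Scheme.{u}) [SchemeCharP p V] (W : V.Opens) : InCharP p Γ(V, W) where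
  cast_eq_zero := by
    have h := congrArg (V.presheaf.map (homOfLE le_top : W ⟶ ⊤).op).hom
      (SchemeCharP.cast_eq_zero (p := p) (V := V))
    simpa using h

/-- `V` is `F`-finite: the Frobenius endomorphism is a finite morphism. -/
def IsFFinite (p : ℕ) [Fact p.Prime] (V : Scheme.{u}) [SchemeCharP p V] : Prop :=
  ∀ W : V.affineOpens, (iterFrob p 1 Γ(V, W.1)).Finite

/-- `V` is `F`-pure: locally on `V` the Frobenius `𝒪_V → F_* 𝒪_V` splits. (For `F`-finite
Noetherian schemes this is equivalent to the purity of Frobenius at all local rings.) -/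
def IsFPure (p : ℕ) (V : Scheme.{u}) : Prop :=
  ∀ v : V, ∃ W : V.affineOpens, v ∈ W.1 ∧
    ∃ θ : CartierMap p 1 Γ(V, W.1) Γ(V, W.1), θ.toAddMonoidHom 1 = 1

/-- `L` is a line bundle: every point has an open neighbourhood `U` on which some section `s`
trivializes `L`. -/
def IsLineBundle {X : Scheme.{u}} (L : X.Modules) : Prop :=
  ∀ x : X, ∃ (U : X.Opens) (_ : x ∈ U) (s : Γ(L, U)), ∀ (U' : X.Opens) (h : U' ≤ U),
    Function.Bijective fun r : Γ(X, U') => r • L.presheaf.map (homOfLE h).op s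

/-- An `𝒪_V`-linear map `F^e_* M → 𝒪_V`, given on affine opens. -/
structure SheafCartierMap (p e : ℕ) (V : Scheme.{u}) (M : V.Modules) where
  app (W : V.affineOpens) : CartierMap p e Γ(V, W.1) Γ(M, W.1)
  app_res {W' W : V.affineOpens} (h : W'.1 ≤ W.1) (m : Γ(M, W.1)) :
    (app W').toAddMonoidHom (M.presheaf.map (homOfLE h).op m) =
      V.presheaf.map (homOfLE h).op ((app W).toAddMonoidHom m)

/-- `Ψ` generates `ℋom(F^e_* M, 𝒪_V)` as an `F^e_* 𝒪_V`-module. On a quasi-Gorenstein scheme this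
is the case for the standard map out of `M = ω_V^{1 - p^e} = 𝒪_V((1 - p^e) K_V)`. -/
def SheafCartierMap.Generates {p e : ℕ} {V : Scheme.{u}} {M : V.Modules}
    (Ψ : SheafCartierMap p e V M) : Prop :=
  ∀ (W : V.affineOpens) (θ : CartierMap p e Γ(V, W.1) Γ(M, W.1)),
    ∃ a : Γ(V, W.1), ∀ m, θ.toAddMonoidHom m = (Ψ.app W).toAddMonoidHom (a • m)

/-- An affine chart of `f : X ⟶ V`: affine opens `U ⊆ X` and `W ⊆ V` with `f(U) ⊆ W`. -/
structure Chart {X V : Scheme.{u}} (f : X ⟶ V) where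
  U : X.affineOpens
  W : V.affineOpens
  le : U.1 ≤ f ⁻¹ᵁ W.1

namespace Chart

variable {X V : Scheme.{u}} {f : X ⟶ V}

/-- The ring `A = 𝒪_V(W)`. -/
def A (c : Chart f) : Type u := Γ(V, c.W.1)

/-- The ring `R = 𝒪_X(U)`. -/
def R (c : Chart f) : Type u := Γ(X, c.U.1)

/-- The `R`-module `L(U)`. -/
def sec (c : Chart f) (L : X.Modules) : Type u := Γ(L, c.U.1)

/-- The `A`-module `M(W)`. -/
def baseSec (c : Chart f) (M : V.Modules) : Type u := Γ(M, c.W.1)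

instance (c : Chart f) : CommRing c.A := inferInstanceAs (CommRing Γ(V, c.W.1))

instance (c : Chart f) : CommRing c.R := inferInstanceAs (CommRing Γ(X, c.U.1))

instance (c : Chart f) : Algebra c.A c.R :=
  RingHom.toAlgebra (R := c.A) (S := c.R) (f.appLE c.W.1 c.U.1 c.le).hom

instance (c : Chart f) (L : X.Modules) : AddCommGroup (c.sec L) :=
  inferInstanceAs (AddCommGroup Γ(L, c.U.1))

instance (c : Chart f) (L : X.Modules) : Module c.R (c.sec L) :=
  inferInstanceAs (Module Γ(X, c.U.1) Γ(L, c.U.1))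

instance (c : Chart f) (L : X.Modules) : Module c.A (c.sec L) :=
  Module.compHom (c.sec L) (algebraMap c.A c.R)

instance (c : Chart f) (L : X.Modules) : IsScalarTower c.A c.R (c.sec L) where
  smul_assoc a r x := by
    rw [Algebra.smul_def, mul_smul]
    rfl

instance (c : Chart f) (M : V.Modules) : AddCommGroup (c.baseSec M) :=
  inferInstanceAs (AddCommGroup Γ(M, c.W.1))

instance (c : Chart f) (M : V.Modules) : Module c.A (c.baseSec M) :=
  inferInstanceAs (Module Γ(V, c.W.1) Γ(M, c.W.1))

instance (p : ℕ) [SchemeCharP p V] (c : Chart f) : InCharP p c.A :=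
  inferInstanceAs (InCharP p Γ(V, c.W.1))

instance (p : ℕ) [SchemeCharP p V] (c : Chart f) : InCharP p c.R where
  cast_eq_zero := by
    have h := congrArg (algebraMap c.A c.R) (InCharP.cast_eq_zero (p := p) (A := c.A))
    simpa using h

/-- Restriction of functions on the base to a smaller chart. -/
def resA {c' c : Chart f} (h : c'.W.1 ≤ c.W.1) : c.A →+* c'.A :=
  (V.presheaf.map (homOfLE h).op).hom

/-- Restriction of functions to a smaller chart. -/
def resR {c' c : Chart f} (h : c'.U.1 ≤ c.U.1) : c.R →+* c'.R :=
  (X.presheaf.map (homOfLE h).op).hom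

/-- Restriction of sections of `L` to a smaller chart. -/
def resSec {c' c : Chart f} (h : c'.U.1 ≤ c.U.1) (L : X.Modules) : c.sec L →+ c'.sec L :=
  (L.presheaf.map (homOfLE h).op).hom

theorem resR_comp {c' c : Chart f} (hU : c'.U.1 ≤ c.U.1) (hW : c'.W.1 ≤ c.W.1) :
    (resR hU).comp (algebraMap c.A c.R) = (algebraMap c'.A c'.R).comp (resA hW) := by
  have h1 : f.appLE c.W.1 c.U.1 c.le ≫ X.presheaf.map (homOfLE hU).op =
      f.appLE c.W.1 c'.U.1 (hU.trans c.le) := Scheme.Hom.appLE_map _ _ _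
  have h2 : V.presheaf.map (homOfLE hW).op ≫ f.appLE c'.W.1 c'.U.1 c'.le =
      f.appLE c.W.1 c'.U.1 (hU.trans c.le) := Scheme.Hom.map_appLE _ _ _
  exact congrArg CommRingCat.Hom.hom (h1.trans h2.symm)

/-- For a point `u : Spec K ⟶ V` with image in `W`, the ring homomorphism `𝒪_V(W) → K`. -/
def evalAt (c : Chart f) {K : Type u} [Field K] (u : Spec (.of K) ⟶ V)
    (h : ⊤ ≤ u ⁻¹ᵁ c.W.1) : c.A →+* K :=
  ((Scheme.ΓSpecIso (.of K)).hom.hom).comp (u.appLE c.W.1 ⊤ h).hom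

end Chart

/-- `Ψ` on the base of an affine chart. -/
def SheafCartierMap.onChart {p e : ℕ} {X V : Scheme.{u}} {f : X ⟶ V} {M : V.Modules}
    (Ψ : SheafCartierMap p e V M) (c : Chart f) : CartierMap p e c.A (c.baseSec M) :=
  Ψ.app c.W

/-- An `𝒪_{X_{V^e}}`-linear map `φ : L^{1/p^e} → R_{A^{1/p^e}}`, that is,
`(F^e_{X^e/V^e})_* L → 𝒪_{X_{V^e}}` where `X_{V^e}` is the base change of `f : X ⟶ V` by the `e`-th
iterate of the Frobenius of `V` and `F^e_{X^e/V^e}` is the relative Frobenius. It is given on the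
affine charts `Spec (R ⊗_A A^{1/p^e})` of `X_{V^e}`, compatibly with restriction. -/
structure RelSheafCartierMap (p e : ℕ) [Fact p.Prime] {X V : Scheme.{u}} [SchemeCharP p V]
    (f : X ⟶ V) (L : X.Modules) where
  app (c : Chart f) : RelCartierMap p e c.A c.R (c.sec L)
  app_res {c' c : Chart f} (hU : c'.U.1 ≤ c.U.1) (hW : c'.W.1 ≤ c.W.1) (l : c.sec L) :
    (app c').toAddMonoidHom (Chart.resSec hU L l) =
      relRingMap p e (Chart.resA hW) (Chart.resR hU) (Chart.resR_comp hU hW)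
        ((app c).toAddMonoidHom l)

section GenericPoint

variable (p : ℕ) [Fact p.Prime] (V : Scheme.{u}) [IsIntegral V] [SchemeCharP p V]

theorem charP_functionField : CharP V.functionField p := by
  have h := congrArg (V.presheaf.germ ⊤ (genericPoint V) trivial).hom
    (SchemeCharP.cast_eq_zero (p := p) (V := V))
  have h0 : (p : V.functionField) = 0 := by
    simpa using h
  exact (CharP.charP_iff_prime_eq_zero Fact.out).2 h0

/-- The perfection `k(V^∞) = k(V)^{1/p^∞}` of the function field of `V`. -/
def perfectFunctionField : Type u :=
  haveI := charP_functionField p V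
  PerfectClosure V.functionField p

instance : Field (perfectFunctionField p V) :=
  haveI := charP_functionField p V
  inferInstanceAs (Field (PerfectClosure V.functionField p))

instance : CharP (perfectFunctionField p V) p :=
  haveI := charP_functionField p V
  inferInstanceAs (CharP (PerfectClosure V.functionField p) p)

instance : PerfectRing (perfectFunctionField p V) p :=
  haveI := charP_functionField p V
  inferInstanceAs (PerfectRing (PerfectClosure V.functionField p) p)

/-- The inclusion `k(V) → k(V^∞)`. -/
def toPerfectFunctionField : V.functionField →+* perfectFunctionField p V :=
  haveI := charP_functionField p V
  PerfectClosure.of V.functionField p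

/-- The perfect generic point `Spec k(V^∞) ⟶ V`. -/
def perfectGenericPoint : Spec (.of (perfectFunctionField p V)) ⟶ V :=
  Spec.map (CommRingCat.ofHom (toPerfectFunctionField p V)) ≫
    V.fromSpecStalk (genericPoint V)

end GenericPoint

namespace RelSheafCartierMap

variable {p e : ℕ} [Fact p.Prime] {X V : Scheme.{u}} [SchemeCharP p V] {f : X ⟶ V} {L : X.Modules}

/-- The relative non-`F`-pure ideal `σ_n(X/V, φ) ⊆ 𝒪_{X_{V^{ne}}}` on the chart
`Spec (R ⊗_A A^{1/p^{ne}})`. -/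
def sigmaN (φ : RelSheafCartierMap p e f L) (n : ℕ) (c : Chart f) :
    Ideal (c.R ⊗[c.A] Root p (e * n) c.A) :=
  (φ.app c).image n

/-- The absolute non-`F`-pure ideal `σ(X_{V^{ne}}, γ) ⊆ 𝒪_{X_{V^{ne}}}` on the chart
`Spec (R ⊗_A A^{1/p^{ne}})`, where `γ` is the map induced by `φ` and `Ψ`. -/
def sigmaGamma (φ : RelSheafCartierMap p e f L) {M : V.Modules} (Ψ : SheafCartierMap p e V M)
    (n : ℕ) (c : Chart f) : Ideal (c.R ⊗[c.A] Root p (e * n) c.A) :=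
  ((φ.app c).gamma (Ψ.onChart c) n).sigma

/-- `n₀` is a uniform integer for `σ` over the generic point of `V`: the descending chain of the
images of the iterates of `ψ_∞` on `X_{k(V^∞)}` is constant from `n₀` on. -/
def IsUniformInteger [IsIntegral V] (φ : RelSheafCartierMap p e f L) (n₀ : ℕ) : Prop :=
  ∀ (c : Chart f) (h : ⊤ ≤ perfectGenericPoint p V ⁻¹ᵁ c.W.1),
    letI : Algebra c.A (perfectFunctionField p V) :=
      (c.evalAt (perfectGenericPoint p V) h).toAlgebra
    ∀ n, n₀ ≤ n → ((φ.app c).fiberMap (perfectFunctionField p V)).image n =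
      ((φ.app c).fiberMap (perfectFunctionField p V)).image n₀

end RelSheafCartierMap

end RelFrob

end

noncomputable section

namespace RelFrob

set_option linter.unusedSectionVars false

/-! Write σ_n for the image of φ^n, an ideal of R ⊗ A^{1/p^{ne}}. The recursion defining φ^{n+1}
says that σ_{n+1} arises from σ_n by an operation `push`. This operation commutes with passage to a
higher root of A (`push_map_levelUp`) and with base change and localization
(`IsGeneratingMap.push_map`). Hence the σ_n form a descending chain once extended to a common level,
a single equality of σ_{n+1} with the extension of σ_n (`IsStableAt`) propagates to all larger n,
and stability is inherited by every base change, in particular by every fibre. Over a perfect field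
K the ring R ⊗ K^{1/p^k} is R itself, so σ_n is the image of the n-th absolute iterate and stability
means that two consecutive images agree.

For the comparison with γ, each m ∈ M gives an A^{1/p^{ne}}-linear map Ψ_m : A^{1/p^{(n+1)e}} →
A^{1/p^{ne}}, a ↦ Ψ(a m) (`evalRoot`), and γ at t · (l ⊗ m) is Ψ_m of the value of φ at l and t
(`gamma_smul_extTmul`). By linearity Ψ_m sends the extension of an ideal of level ne back into that
ideal, so the image of γ^j lies in the extension of σ_j for j ≤ n. If Ψ(m) = 1, then Ψ_m is a
retraction of A^{1/p^{ne}} → A^{1/p^{(n+1)e}}; with stability this gives σ_n ⊆ γ(σ_n N), so σ_n lies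
in the image of every iterate of γ. Thus σ(γ) = σ_n (`sigma_gamma_eq`). Such an m exists near the
generic point: `V` is F-pure, and `Ψ` generates, so a local splitting of F^e is a multiple of `Ψ`.

It remains to spread stability out from the perfect generic fibre. A field K containing A is flat
over A and the ideals are finitely generated, so on each chart some nonzero a ∈ A multiplies the
extension of σ_{n₀} into σ_{n₀+1}. Finitely many charts cover the preimage of an affine open of V,
and inverting the product of their a's gives U. An arbitrary chart over U is compared with these
through common basic open sets, where sections of L have denominators that are powers of one
function. -/

/-! ### Change of level -/

/-- The inclusion `A^{1/p^j} → A^{1/p^k}` for `j ≤ k`. -/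
def rootUp (p : ℕ) [Fact p.Prime] (A : Type*) [CommRing A] [InCharP p A] {j k : ℕ} (h : j ≤ k) :
    Root p j A →ₐ[A] Root p k A where
  toRingHom := (iterFrob p (k - j) A : A →+* A)
  commutes' a := by
    change ((a ^ p ^ j : A)) ^ p ^ (k - j) = a ^ p ^ k
    rw [← pow_mul, ← pow_add, Nat.add_sub_cancel' h]

section Level

variable {p : ℕ} [Fact p.Prime] {A R : Type*} [CommRing A] [InCharP p A] [CommRing R]
  [Algebra A R] {i j k : ℕ}

/-- The ring homomorphism `R ⊗_A A^{1/p^j} → R ⊗_A A^{1/p^k}` for `j ≤ k`. -/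
def levelUp (p : ℕ) [Fact p.Prime] (A R : Type*) [CommRing A] [InCharP p A] [CommRing R]
    [Algebra A R] {j k : ℕ} (h : j ≤ k) : R ⊗[A] Root p j A →ₐ[R] R ⊗[A] Root p k A :=
  Algebra.TensorProduct.map (AlgHom.id R R) (rootUp p A h)

theorem levelUp_tmul (h : j ≤ k) (r : R) (a : Root p j A) :
    levelUp p A R h (r ⊗ₜ a) = r ⊗ₜ toRoot p k (ofRoot a ^ p ^ (k - j)) := rfl

theorem levelUp_levelUp (h : i ≤ j) (h' : j ≤ k) (t : R ⊗[A] Root p i A) :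
    levelUp p A R h' (levelUp p A R h t) = levelUp p A R (h.trans h') t := by
  induction t with
  | zero => simp
  | add t t' ht ht' => simp only [map_add, ht, ht']
  | tmul r a =>
    rw [levelUp_tmul, levelUp_tmul, levelUp_tmul]
    change r ⊗ₜ toRoot p k ((ofRoot a ^ p ^ (j - i)) ^ p ^ (k - j)) = _
    rw [← pow_mul, ← pow_add]
    congr 5
    omega

theorem levelUp_self (t : R ⊗[A] Root p k A) : levelUp p A R le_rfl t = t := by
  induction t with
  | zero => simp
  | add t t' ht ht' => simp only [map_add, ht, ht']
  | tmul r a =>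
    rw [levelUp_tmul, Nat.sub_self, pow_zero, pow_one]
    rfl

theorem map_levelUp_map_levelUp (h : i ≤ j) (h' : j ≤ k) (J : Ideal (R ⊗[A] Root p i A)) :
    (J.map (levelUp p A R h)).map (levelUp p A R h') = J.map (levelUp p A R (h.trans h')) := by
  rw [Ideal.map_mapₐ]
  congr 1
  exact AlgHom.ext fun t => levelUp_levelUp h h' t

theorem map_levelUp_self (J : Ideal (R ⊗[A] Root p k A)) :
    J.map (levelUp p A R (le_refl k)) = J := by
  have h : levelUp p A R (le_refl k) = AlgHom.id R _ := AlgHom.ext levelUp_self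
  rw [h]
  exact Ideal.map_id J

theorem relRingMap_tmul {A' R' : Type*} [CommRing A'] [InCharP p A'] [CommRing R'] [Algebra A' R']
    (g : A →+* A') (h : R →+* R') (hgh : h.comp (algebraMap A R) = (algebraMap A' R').comp g)
    (r : R) (a : Root p k A) :
    relRingMap p k g h hgh (r ⊗ₜ a) = h r ⊗ₜ toRoot p k (g (ofRoot a)) := by
  rw [relRingMap, Algebra.TensorProduct.mapRingHom_tmul]
  rfl

theorem relRingMap_levelUp {A' R' : Type*} [CommRing A'] [InCharP p A'] [CommRing R']
    [Algebra A' R'] (g : A →+* A') (h : R →+* R')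
    (hgh : h.comp (algebraMap A R) = (algebraMap A' R').comp g) (hjk : j ≤ k)
    (t : R ⊗[A] Root p j A) :
    relRingMap p k g h hgh (levelUp p A R hjk t) =
      levelUp p A' R' hjk (relRingMap p j g h hgh t) := by
  induction t with
  | zero => simp
  | add t t' ht ht' => simp only [map_add, ht, ht']
  | tmul r a =>
    rw [levelUp_tmul, relRingMap_tmul, relRingMap_tmul, levelUp_tmul]
    congr 1
    exact map_pow g _ _

theorem map_relRingMap_levelUp {A' R' : Type*} [CommRing A'] [InCharP p A'] [CommRing R']
    [Algebra A' R'] (g : A →+* A') (h : R →+* R')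
    (hgh : h.comp (algebraMap A R) = (algebraMap A' R').comp g) (hjk : j ≤ k)
    (J : Ideal (R ⊗[A] Root p j A)) :
    (J.map (levelUp p A R hjk)).map (relRingMap p k g h hgh) =
      (J.map (relRingMap p j g h hgh)).map (levelUp p A' R' hjk) := by
  change (J.map (levelUp p A R hjk).toRingHom).map _ = Ideal.map (levelUp p A' R' hjk).toRingHom _
  rw [Ideal.map_map, Ideal.map_map]
  congr 1
  exact RingHom.ext fun t => relRingMap_levelUp g h hgh hjk t

end Level

/-! ### The images of the iterates -/

namespace RelCartierMap

variable {p e : ℕ} [Fact p.Prime] {A R L : Type u} [CommRing A] [InCharP p A]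
    [CommRing R] [InCharP p R] [Algebra A R] [AddCommGroup L] [Module A L] [Module R L]
    [IsScalarTower A R L]

/-- The value of `φ ⊗_{A^{1/p^e}} A^{1/p^{k+e}}` at the product of `l ∈ L` and
`t ∈ R ⊗_A A^{1/p^k}`. -/
def pair (φ : RelCartierMap p e A R L) (k : ℕ) (l : L) (t : R ⊗[A] Root p k A) :
    R ⊗[A] Root p (k + e) A :=
  LinearMap.baseChange R (frobRoot p k e A) (φ.twist (Root p k A)
    (TensorProduct.AlgebraTensorModule.cancelBaseChange A R R L (Root p k A) (l ⊗ₜ t)))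

variable (φ : RelCartierMap p e A R L) {j k : ℕ}

/-- The factor from A^{1/p^k} rides along by linearity, so only φ(r l), raised to level k + e,
remains. The identities for `pair` below are checked on pure tensors through this formula. -/
theorem pair_tmul (l : L) (r : R) (a : Root p k A) :
    φ.pair k l (r ⊗ₜ a) = levelUp p A R (Nat.le_add_left e k) (φ.toAddMonoidHom (r • l)) *
      ((1 : R) ⊗ₜ toRoot p (k + e) (ofRoot a)) := by
  have h1 : φ.pair k l (r ⊗ₜ a) = LinearMap.baseChange R (frobRoot p k e A)
      (actOn p e A R a (φ.toAddMonoidHom (r • l))) := by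
    rw [pair, TensorProduct.AlgebraTensorModule.cancelBaseChange_tmul]
    rfl
  rw [h1]
  generalize φ.toAddMonoidHom (r • l) = t
  induction t with
  | zero => simp
  | add t t' ht ht' => simp only [map_add, ht, ht', add_mul]
  | tmul r b =>
    rw [levelUp_tmul, Algebra.TensorProduct.tmul_mul_tmul, mul_one]
    change r ⊗ₜ frobRoot p k e A (toFrob p e (ofRoot b • a)) = _
    congr 1
    change ofRoot b ^ p ^ k * ofRoot a = ofRoot b ^ p ^ (k + e - e) * ofRoot a
    rw [Nat.add_sub_cancel]

theorem pair_add_left (l l' : L) (t : R ⊗[A] Root p k A) :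
    φ.pair k (l + l') t = φ.pair k l t + φ.pair k l' t := by
  simp only [pair, TensorProduct.add_tmul, map_add]

theorem pair_add_right (l : L) (t t' : R ⊗[A] Root p k A) :
    φ.pair k l (t + t') = φ.pair k l t + φ.pair k l t' := by
  simp only [pair, TensorProduct.tmul_add, map_add]

theorem pair_zero_left (t : R ⊗[A] Root p k A) : φ.pair k 0 t = 0 := by
  simp only [pair, TensorProduct.zero_tmul, map_zero]

theorem pair_zero_right (l : L) : φ.pair k l 0 = 0 := by
  simp only [pair, TensorProduct.tmul_zero, map_zero]

/-- The product of l and t is taken over R, so r crosses to l, while the root of a comes out as a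
scalar. -/
theorem pair_tmul_mul (l : L) (r : R) (a : Root p k A) (t : R ⊗[A] Root p k A) :
    φ.pair k l ((r ⊗ₜ a) * t) =
      ((1 : R) ⊗ₜ toRoot p (k + e) (ofRoot a)) * φ.pair k (r • l) t := by
  induction t with
  | zero => simp only [mul_zero, pair_zero_right]
  | add t t' ht ht' => rw [mul_add, pair_add_right, ht, ht', pair_add_right, mul_add]
  | tmul s b =>
    rw [Algebra.TensorProduct.tmul_mul_tmul, pair_tmul, pair_tmul, mul_left_comm,
      Algebra.TensorProduct.tmul_mul_tmul, one_mul, smul_smul, mul_comm s r]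
    rfl

/-- The exponent p^k only rewrites a^{1/p^e} as a root of order p^{k+e}. -/
theorem pair_pow_smul (r : R) (a : A) (l : L) (t : R ⊗[A] Root p k A) :
    φ.pair k (r ^ p ^ e • a • l) t =
      (r ⊗ₜ toRoot p (k + e) (a ^ p ^ k)) * φ.pair k l t := by
  induction t with
  | zero => simp only [mul_zero, pair_zero_right]
  | add t t' ht ht' => rw [pair_add_right, ht, ht', pair_add_right, mul_add]
  | tmul s b =>
    rw [pair_tmul, pair_tmul, smul_comm s, smul_comm s a l]
    have h : φ.toAddMonoidHom (r ^ p ^ e • a • s • l) =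
      (r ⊗ₜ[A] toRoot p e a) * φ.toAddMonoidHom (s • l) := φ.map_smul' r a (s • l)
    rw [h, map_mul, mul_assoc, levelUp_tmul, Nat.add_sub_cancel]
    rfl

theorem levelUp_pair (h : j ≤ k) (l : L) (t : R ⊗[A] Root p j A) :
    levelUp p A R (Nat.add_le_add_right h e) (φ.pair j l t) =
      φ.pair k l (levelUp p A R h t) := by
  induction t with
  | zero => simp only [pair_zero_right, map_zero]
  | add t t' ht ht' => rw [pair_add_right, map_add, ht, ht', map_add, pair_add_right]
  | tmul s b =>
    rw [pair_tmul, map_mul, levelUp_levelUp, levelUp_tmul, levelUp_tmul, pair_tmul,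
      Nat.add_sub_add_right]
    rfl

/-- The ideal of `R ⊗_A A^{1/p^{k+e}}` which is the image of `(L ⊗_R J)^{1/p^e}` under
`φ ⊗_{A^{1/p^e}} A^{1/p^{k+e}}`, for an ideal `J` of `R ⊗_A A^{1/p^k}`. -/
def push (k : ℕ) (J : Ideal (R ⊗[A] Root p k A)) : Ideal (R ⊗[A] Root p (k + e) A) :=
  Ideal.span {y | ∃ l : L, ∃ t ∈ J, φ.pair k l t = y}

theorem pair_mem_push {J : Ideal (R ⊗[A] Root p k A)} (l : L) {t : R ⊗[A] Root p k A}
    (ht : t ∈ J) : φ.pair k l t ∈ φ.push k J :=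
  Ideal.subset_span ⟨l, t, ht, rfl⟩

/-- Membership may be tested on generators of the ideal, provided that all l are allowed: a
multiplier r ⊗ a of t is absorbed by replacing l with r l and extracting a. -/
theorem pair_mem_of_mem_span {Z : Set (R ⊗[A] Root p k A)} {I : Ideal (R ⊗[A] Root p (k + e) A)}
    (h : ∀ l, ∀ t ∈ Z, φ.pair k l t ∈ I) (l : L) {t : R ⊗[A] Root p k A}
    (ht : t ∈ Ideal.span Z) : φ.pair k l t ∈ I := by
  revert l
  refine Submodule.span_induction (fun t ht l => h l t ht) ?_ ?_ ?_ ht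
  · intro l; rw [pair_zero_right]; exact Ideal.zero_mem _
  · intro t t' _ _ ht ht' l; rw [pair_add_right]; exact Ideal.add_mem _ (ht l) (ht' l)
  · intro s t _ ht l
    rw [smul_eq_mul]
    induction s with
    | zero => rw [zero_mul, pair_zero_right]; exact Ideal.zero_mem _
    | add s s' hs hs' => rw [add_mul, pair_add_right]; exact Ideal.add_mem _ hs hs'
    | tmul r a => rw [pair_tmul_mul]; exact Ideal.mul_mem_left _ _ (ht _)

theorem push_mono {J J' : Ideal (R ⊗[A] Root p k A)} (h : J ≤ J') : φ.push k J ≤ φ.push k J' :=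
  Ideal.span_mono fun _ ⟨l, t, ht, hy⟩ => ⟨l, t, h ht, hy⟩

/-- Finite sums of values of `pair` already form an ideal, so no multipliers are needed in the
induction. This matters for the maps built from `Ψ`, which are linear only over the lower level. -/
theorem push_induction {J : Ideal (R ⊗[A] Root p k A)}
    {motive : R ⊗[A] Root p (k + e) A → Prop} (h0 : motive 0)
    (ha : ∀ y y', motive y → motive y' → motive (y + y'))
    (hp : ∀ l, ∀ t ∈ J, motive (φ.pair k l t)) {y : R ⊗[A] Root p (k + e) A}
    (hy : y ∈ φ.push k J) : motive y := by
  induction hy using Submodule.span_induction with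
  | zero => exact h0
  | add x y _ _ hx hy => exact ha x y hx hy
  | mem x hx => obtain ⟨l, t, ht, rfl⟩ := hx; exact hp l t ht
  | smul s x hx hm => ?_
  clear hm
  revert s
  induction hx using Submodule.span_induction with
  | zero => intro s; rwa [smul_zero]
  | add x y _ _ hx hy => intro s; rw [smul_add]; exact ha _ _ (hx s) (hy s)
  | smul s' x _ hx => intro s; rw [smul_smul]; exact hx _
  | mem x hx =>
    obtain ⟨l, t, ht, rfl⟩ := hx
    intro s
    induction s with
    | zero => rwa [zero_smul]
    | add s s' hs hs' => rw [add_smul]; exact ha _ _ hs hs'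
    | tmul r a =>
      -- The multiplier is absorbed on both sides: r as r^{p^e} into l, and the root of a into t,
      -- which stays in J.
      have h := φ.pair_tmul_mul (k := k) (r ^ p ^ e • l) 1 (toRoot p k (ofRoot a)) t
      have h2 := φ.pair_pow_smul r 1 l t
      rw [one_smul] at h h2
      rw [h2, ← mul_assoc, Algebra.TensorProduct.tmul_mul_tmul, one_pow, one_mul] at h
      have h3 : toRoot p (k + e) (ofRoot (toRoot p k (ofRoot a))) * toRoot p (k + e) (1 : A) = a :=
        mul_one (ofRoot a : A)
      rw [h3] at h
      rw [smul_eq_mul, ← h]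
      exact hp _ _ (J.mul_mem_left _ ht)

/-- Raising the level is compatible with `pair`, and the extended ideal is generated by the elements
coming from J. This makes both monotonicity and stability of the chain propagate. -/
theorem push_map_levelUp (h : j ≤ k) (J : Ideal (R ⊗[A] Root p j A)) :
    φ.push k (J.map (levelUp p A R h)) =
      (φ.push j J).map (levelUp p A R (Nat.add_le_add_right h e)) := by
  apply le_antisymm
  · refine Ideal.span_le.2 ?_
    rintro _ ⟨l, t, ht, rfl⟩
    refine φ.pair_mem_of_mem_span ?_ l ht
    · rintro l _ ⟨t, ht, rfl⟩
      exact (levelUp_pair φ h l t).symm ▸ Ideal.mem_map_of_mem _ (φ.pair_mem_push l ht)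
  · refine Ideal.map_le_iff_le_comap.2 (Ideal.span_le.2 ?_)
    rintro _ ⟨l, t, ht, rfl⟩
    change levelUp p A R (Nat.add_le_add_right h e) (φ.pair j l t) ∈
      φ.push k (J.map (levelUp p A R h))
    rw [levelUp_pair φ h]
    exact φ.pair_mem_push l (Ideal.mem_map_of_mem _ ht)

theorem image_zero : φ.image 0 = ⊤ := by
  rw [Ideal.eq_top_iff_one]
  exact Ideal.subset_span ⟨(1 : R), map_one (algebraMap R (R ⊗[A] Root p (e * 0) A))⟩

theorem span_range_step {D : Type u} [AddCommGroup D] [Module R D]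
    (g : D →ₗ[R] R ⊗[A] Root p k A) :
    Ideal.span (Set.range (φ.step k g)) = φ.push k (Ideal.span (Set.range g)) := by
  apply le_antisymm
  · refine Ideal.span_le.2 ?_
    rintro _ ⟨x, rfl⟩
    obtain ⟨x, rfl⟩ : ∃ y : L ⊗[R] D, toFrob p e y = x := ⟨ofFrob x, rfl⟩
    induction x with
    | zero => exact (map_zero (φ.step k g)) ▸ Ideal.zero_mem _
    | add x y hx hy =>
      have h : φ.step k g (toFrob p e (x + y)) =
        φ.step k g (toFrob p e x) + φ.step k g (toFrob p e y) := map_add (φ.step k g) _ _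
      rw [h]
      exact Ideal.add_mem _ hx hy
    | tmul l d => exact φ.pair_mem_push l (Ideal.subset_span ⟨d, rfl⟩)
  · refine Ideal.span_le.2 ?_
    rintro _ ⟨l, t, ht, rfl⟩
    refine φ.pair_mem_of_mem_span ?_ l ht
    · rintro l _ ⟨d, rfl⟩
      exact Ideal.subset_span ⟨toFrob p e (l ⊗ₜ d), rfl⟩

theorem image_succ (n : ℕ) : φ.image (n + 1) = φ.push (e * n) (φ.image n) :=
  φ.span_range_step (φ.iter n)

theorem mul_le_mul_succ (e n : ℕ) : e * n ≤ e * (n + 1) := Nat.mul_le_mul_left e n.le_succ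

theorem image_succ_le (n : ℕ) :
    φ.image (n + 1) ≤ (φ.image n).map (levelUp p A R (mul_le_mul_succ e n)) := by
  induction n with
  | zero =>
    rw [image_zero, Ideal.map_top]
    exact le_top
  | succ n ih =>
    rw [image_succ φ (n + 1), image_succ φ n]
    exact (φ.push_mono (image_succ φ n ▸ ih)).trans (φ.push_map_levelUp _ _).le

/-- The images of the iterates of `φ` are stable from the `n`-th one on. -/
def IsStableAt (n : ℕ) : Prop :=
  φ.image (n + 1) = (φ.image n).map (levelUp p A R (mul_le_mul_succ e n))

variable {φ}

/-- Each image depends only on the previous one through `push`, so it suffices to apply `push` to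
the equality. -/
theorem IsStableAt.succ {n : ℕ} (h : φ.IsStableAt n) : φ.IsStableAt (n + 1) := by
  have h1 := φ.push_map_levelUp (mul_le_mul_succ e n) (φ.image n)
  rw [← show φ.image (n + 1) = _ from h, ← image_succ, ← image_succ] at h1
  exact h1

theorem IsStableAt.of_le {n m : ℕ} (h : φ.IsStableAt n) (hnm : n ≤ m) : φ.IsStableAt m := by
  induction m, hnm using Nat.le_induction with
  | base => exact h
  | succ m _ ih => exact ih.succ

variable (φ)

/-! ### Functoriality -/

section Functoriality

variable {A' R' L' : Type u} [CommRing A'] [InCharP p A'] [CommRing R'] [InCharP p R']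
  [Algebra A' R'] [AddCommGroup L'] [Module A' L'] [Module R' L'] [IsScalarTower A' R' L']
  {φ' : RelCartierMap p e A' R' L'} {φ}

/-- A morphism from `φ` to `φ'` over a commutative square from `A → R` to `A' → R'`, such that
`L'` is generated over the image of the relative Frobenius by the image of `L`. -/
structure IsGeneratingMap (φ : RelCartierMap p e A R L) (φ' : RelCartierMap p e A' R' L')
    (g : A →+* A') (h : R →+* R') (hgh : h.comp (algebraMap A R) = (algebraMap A' R').comp g)
    (q : L →+ L') : Prop where
  smul : ∀ (r : R) (l : L), q (r • l) = h r • q l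
  comp : ∀ l, φ'.toAddMonoidHom (q l) = relRingMap p e g h hgh (φ.toAddMonoidHom l)
  generates : ∀ l', l' ∈ AddSubgroup.closure {x | ∃ (r : R') (a : A') (l : L),
    r ^ p ^ e • a • q l = x}

namespace IsGeneratingMap

variable {g : A →+* A'} {h : R →+* R'} {hgh : h.comp (algebraMap A R) = (algebraMap A' R').comp g}
  {q : L →+ L'}

theorem relRingMap_pair (H : IsGeneratingMap φ φ' g h hgh q)
    (l : L) (t : R ⊗[A] Root p k A) :
    relRingMap p (k + e) g h hgh (φ.pair k l t) = φ'.pair k (q l) (relRingMap p k g h hgh t) := by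
  induction t with
  | zero => simp only [pair_zero_right, map_zero]
  | add t t' ht ht' => rw [pair_add_right, map_add, ht, ht', map_add, pair_add_right]
  | tmul s b =>
    rw [pair_tmul, map_mul, relRingMap_levelUp, relRingMap_tmul, relRingMap_tmul, pair_tmul,
      ← H.comp, H.smul, map_one]
    rfl

/-- Naturality of `pair` gives one inclusion. For the other, an element of L' is a sum of terms
r^{p^e} a q(l), whose scalars leave `pair` as multipliers. -/
theorem push_map (H : IsGeneratingMap φ φ' g h hgh q)
    (J : Ideal (R ⊗[A] Root p k A)) :
    φ'.push k (J.map (relRingMap p k g h hgh)) =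
      (φ.push k J).map (relRingMap p (k + e) g h hgh) := by
  apply le_antisymm
  · refine Ideal.span_le.2 ?_
    rintro _ ⟨l, t, ht, rfl⟩
    refine φ'.pair_mem_of_mem_span ?_ l ht
    · rintro l _ ⟨t, ht, rfl⟩
      refine AddSubgroup.closure_induction ?_ ?_ ?_ ?_ (H.generates l)
      · rintro _ ⟨r, a, l, rfl⟩
        rw [pair_pow_smul, ← H.relRingMap_pair]
        exact Ideal.mul_mem_left _ _ (Ideal.mem_map_of_mem _ (φ.pair_mem_push l ht))
      · rw [pair_zero_left]; exact Ideal.zero_mem _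
      · intro l l' _ _ hl hl'; rw [pair_add_left]; exact Ideal.add_mem _ hl hl'
      · intro l _ hl
        have h2 := φ'.pair_add_left l (-l) (relRingMap p k g h hgh t)
        rw [add_neg_cancel, pair_zero_left] at h2
        rw [← neg_eq_of_add_eq_zero_right h2.symm]
        exact neg_mem hl
  · refine Ideal.map_le_iff_le_comap.2 (Ideal.span_le.2 ?_)
    rintro _ ⟨l, t, ht, rfl⟩
    change relRingMap p (k + e) g h hgh (φ.pair k l t) ∈ φ'.push k (J.map (relRingMap p k g h hgh))
    rw [H.relRingMap_pair]
    exact φ'.pair_mem_push _ (Ideal.mem_map_of_mem _ ht)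

/-- Only extensions of ideals are compared, so no flatness enters: the same statement serves fibres
and restrictions to basic open sets. -/
theorem image_eq (H : IsGeneratingMap φ φ' g h hgh q) (n : ℕ) :
    φ'.image n = (φ.image n).map (relRingMap p (e * n) g h hgh) := by
  induction n with
  | zero => rw [image_zero, image_zero, Ideal.map_top]
  | succ n ih => rw [image_succ, ih, H.push_map, image_succ]; rfl

theorem isStableAt (H : IsGeneratingMap φ φ' g h hgh q) {n : ℕ}
    (hn : φ.IsStableAt n) : φ'.IsStableAt n := by
  rw [IsStableAt, H.image_eq, H.image_eq, ← map_relRingMap_levelUp,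
    ← show φ.image (n + 1) = _ from hn]

end IsGeneratingMap

theorem isGeneratingMap_baseChange (φ : RelCartierMap p e A R L) (B : Type u) [CommRing B]
    [InCharP p B] [Algebra A B] :
    IsGeneratingMap φ (φ.baseChange B) (algebraMap A B)
      (Algebra.TensorProduct.includeRight : R →ₐ[A] B ⊗[A] R).toRingHom
      (RingHom.ext fun a => by simp)
      (AddMonoidHom.mk' (fun l => (extTmul (1 : B) l : ExtTensor A B R B L))
        (fun l l' => TensorProduct.tmul_add _ _ _)) where
  smul r l := by
    change extTmul 1 (r • l) = ((1 : B) ⊗ₜ[A] r) • (extTmul 1 l : ExtTensor A B R B L)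
    rw [smul_extTmul, one_smul]
  comp l := by
    change baseChangeHom φ B (extTmul 1 l) = baseRingMap p e A R B (φ.toFun l)
    rw [baseChangeHom_extTmul]
    exact one_mul _
  generates x := by
    induction x using ext_induction with
    | h0 => exact zero_mem _
    | ha x y hx hy => exact add_mem hx hy
    | ht b l =>
      refine AddSubgroup.subset_closure ⟨1, b, l, ?_⟩
      rw [one_pow, one_smul]
      change (b ⊗ₜ[A] (1 : R)) • (extTmul 1 l : ExtTensor A B R B L) = _
      rw [smul_extTmul, one_smul, smul_eq_mul, mul_one]

theorem image_baseChange (φ : RelCartierMap p e A R L) (B : Type u) [CommRing B]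
    [InCharP p B] [Algebra A B] (n : ℕ) :
    (φ.baseChange B).image n = (φ.image n).map (baseRingMap p (e * n) A R B) :=
  (isGeneratingMap_baseChange φ B).image_eq n

end Functoriality

end RelCartierMap

/-! ### Images of absolute `p^{-e}`-linear maps -/

namespace CartierMap

variable {p e : ℕ} [Fact p.Prime] {S N : Type u} [CommRing S] [InCharP p S] [AddCommGroup N]
  [Module S N] (ψ : CartierMap p e S N)

/-- The ideal `ψ(F^e_*(J N))`, for an ideal `J`. -/
def push (J : Ideal S) : Ideal S := Ideal.span {y | ∃ t ∈ J, ∃ x, ψ.toAddMonoidHom (t • x) = y}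

theorem map_smul_mem_push {J : Ideal S} {t : S} (ht : t ∈ J) (x : N) :
    ψ.toAddMonoidHom (t • x) ∈ ψ.push J := Ideal.subset_span ⟨t, ht, x, rfl⟩

theorem push_mono {J J' : Ideal S} (h : J ≤ J') : ψ.push J ≤ ψ.push J' :=
  Ideal.span_mono fun _ ⟨t, ht, hx⟩ => ⟨t, h ht, hx⟩

theorem range_step {D : Type u} [AddCommGroup D] [Module S D] (g : D →ₗ[S] S) :
    LinearMap.range (ψ.step g) = ψ.push (LinearMap.range g) := by
  apply le_antisymm
  · rintro _ ⟨x, rfl⟩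
    obtain ⟨x, rfl⟩ : ∃ y : N ⊗[S] D, toFrob p e y = x := ⟨ofFrob x, rfl⟩
    induction x with
    | zero => exact (map_zero (ψ.step g)) ▸ Ideal.zero_mem _
    | add x y hx hy =>
      have h : ψ.step g (toFrob p e (x + y)) =
        ψ.step g (toFrob p e x) + ψ.step g (toFrob p e y) := map_add (ψ.step g) _ _
      rw [h]
      exact Ideal.add_mem _ hx hy
    | tmul x d => exact ψ.map_smul_mem_push (LinearMap.mem_range_self g d) x
  · refine Ideal.span_le.2 ?_
    rintro _ ⟨_, ⟨d, rfl⟩, x, rfl⟩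
    exact ⟨toFrob p e (x ⊗ₜ d), rfl⟩

theorem image_zero : ψ.image 0 = ⊤ := LinearMap.range_id

theorem image_succ (n : ℕ) : ψ.image (n + 1) = ψ.push (ψ.image n) := ψ.range_step (ψ.iter n)

theorem image_succ_le (n : ℕ) : ψ.image (n + 1) ≤ ψ.image n := by
  induction n with
  | zero => rw [image_zero]; exact le_top
  | succ n ih => rw [image_succ ψ (n + 1), image_succ ψ n]; exact ψ.push_mono (image_succ ψ n ▸ ih)

theorem sigma_eq_image {n : ℕ} (h : ∀ m, n ≤ m → ψ.image (m + 1) = ψ.image m) :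
    ψ.sigma = ψ.image n := by
  have h2 : ∀ m, n ≤ m → ψ.image m = ψ.image n := fun m hm => by
    induction m, hm using Nat.le_induction with
    | base => rfl
    | succ m hm ih => rw [h m hm, ih]
  refine le_antisymm (iInf_le _ n) (le_iInf fun m => ?_)
  rcases le_total n m with hm | hm
  · exact (h2 m hm).ge
  · exact antitone_nat_of_succ_le ψ.image_succ_le hm

/-- Starting from J ⊆ S and applying ψ repeatedly keeps J inside every image. -/
theorem le_sigma {J : Ideal S} (h : J ≤ ψ.push J) : J ≤ ψ.sigma := by
  refine le_iInf fun n => ?_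
  induction n with
  | zero => rw [image_zero]; exact le_top
  | succ n ih => rw [image_succ]; exact h.trans (ψ.push_mono ih)

end CartierMap

/-! ### The images of the iterates of `γ` -/

namespace RelCartierMap

variable {p e : ℕ} [Fact p.Prime] {A R L : Type u} [CommRing A] [InCharP p A]
    [CommRing R] [InCharP p R] [Algebra A R] [AddCommGroup L] [Module A L] [Module R L]
    [IsScalarTower A R L] {M : Type u} [AddCommGroup M] [Module A M]

/-- The map `A^{1/p^{k+e}} → A^{1/p^k}` given by `a^{1/p^{k+e}} ↦ Ψ(a m)^{1/p^k}`, for `m ∈ M`. -/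
def evalRoot (Ψ : CartierMap p e A M) (k : ℕ) (m : M) : Root p (k + e) A →ₗ[A] Root p k A where
  toFun a := toRoot p k (Ψ.toAddMonoidHom ((ofRoot a : A) • m))
  map_add' a b := by
    change Ψ.toAddMonoidHom (((ofRoot a : A) + (ofRoot b : A)) • m) = _
    rw [add_smul, map_add]
    rfl
  map_smul' a b := by
    change Ψ.toAddMonoidHom ((a ^ p ^ (k + e) * ofRoot b : A) • m) =
      a ^ p ^ k * Ψ.toAddMonoidHom ((ofRoot b : A) • m)
    rw [pow_add, pow_mul, mul_smul]
    exact Ψ.map_smul' _ _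

/-- A scalar from level k becomes a p^e-th power at level k + e, hence leaves `Ψ` by
p^{-e}-linearity. -/
theorem baseChange_evalRoot_mul_levelUp (Ψ : CartierMap p e A M) (k : ℕ) (m : M)
    (y : R ⊗[A] Root p (k + e) A) (t : R ⊗[A] Root p k A) :
    LinearMap.baseChange R (evalRoot Ψ k m) (y * levelUp p A R (Nat.le_add_right k e) t) =
      LinearMap.baseChange R (evalRoot Ψ k m) y * t := by
  induction y with
  | zero => simp only [zero_mul, map_zero]
  | add y y' hy hy' => rw [add_mul, map_add, hy, hy', map_add, add_mul]
  | tmul r a =>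
    induction t with
    | zero => simp only [mul_zero, map_zero]
    | add t t' ht ht' => rw [map_add, mul_add, map_add, ht, ht', mul_add]
    | tmul s b =>
      rw [levelUp_tmul, Algebra.TensorProduct.tmul_mul_tmul, LinearMap.baseChange_tmul,
        LinearMap.baseChange_tmul, Algebra.TensorProduct.tmul_mul_tmul]
      congr 1
      change Ψ.toAddMonoidHom ((ofRoot a * ofRoot b ^ p ^ (k + e - k) : A) • m) =
        Ψ.toAddMonoidHom ((ofRoot a : A) • m) * ofRoot b
      rw [Nat.add_sub_cancel_left, mul_comm, mul_smul, mul_comm]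
      exact Ψ.map_smul' _ _

theorem baseChange_evalRoot_mem (Ψ : CartierMap p e A M) {k : ℕ} (m : M)
    {I : Ideal (R ⊗[A] Root p k A)} {y : R ⊗[A] Root p (k + e) A}
    (hy : y ∈ I.map (levelUp p A R (Nat.le_add_right k e))) :
    LinearMap.baseChange R (evalRoot Ψ k m) y ∈ I := by
  -- The multiplier s makes the span induction go through, since the map is not linear over the
  -- upper level.
  have h : ∀ s, LinearMap.baseChange R (evalRoot Ψ k m) (s * y) ∈ I := by
    induction hy using Submodule.span_induction with
    | mem y hy =>
      obtain ⟨z, hz, rfl⟩ := hy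
      intro s
      have h3 := baseChange_evalRoot_mul_levelUp (R := R) Ψ k m s z
      exact h3 ▸ Ideal.mul_mem_left _ _ hz
    | zero => intro s; rw [mul_zero, map_zero]; exact Ideal.zero_mem _
    | add y y' _ _ hy hy' =>
      intro s; rw [mul_add, map_add]; exact Ideal.add_mem _ (hy s) (hy' s)
    | smul s' y _ hy => intro s; rw [smul_eq_mul, ← mul_assoc]; exact hy _
  simpa only [one_mul] using h 1

variable (φ : RelCartierMap p e A R L) (Ψ : CartierMap p e A M)

/-- This is the bridge between the absolute map γ and the relative map φ: raise the level with φ,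
then come back down with `Ψ` evaluated against m. -/
theorem gamma_smul_extTmul (n : ℕ) (t : R ⊗[A] Root p (e * n) A) (l : L) (m : M) :
    (φ.gamma Ψ n).toAddMonoidHom
        (t • (extTmul l (toFrob p (e * n) m) : GammaSource p e A R L M n)) =
      LinearMap.baseChange R (evalRoot Ψ (e * n) m) (φ.pair (e * n) l t) := by
  induction t with
  | zero => rw [zero_smul, pair_zero_right, map_zero, map_zero]
  | add t t' ht ht' => rw [add_smul, map_add, ht, ht', pair_add_right, map_add]
  | tmul r b =>
    rw [smul_extTmul, pair_tmul]
    change LinearMap.baseChange R (rootOf Ψ (e * n)) (actOn p e A R (b • toFrob p (e * n) m)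
      (φ.toAddMonoidHom (r • l))) = _
    generalize φ.toAddMonoidHom (r • l) = t
    induction t with
    | zero => simp only [zero_mul, map_zero]
    | add t t' ht ht' => simp only [map_add, ht, ht', add_mul]
    | tmul s a =>
      rw [levelUp_tmul, Algebra.TensorProduct.tmul_mul_tmul, mul_one, LinearMap.baseChange_tmul]
      change s ⊗ₜ rootOf Ψ (e * n) (toFrob p e (ofRoot a • (b • toFrob p (e * n) m))) = _
      congr 1
      change Ψ.toAddMonoidHom ((ofRoot a ^ p ^ (e * n) : A) • (ofRoot b : A) • m) =
        Ψ.toAddMonoidHom ((ofRoot a ^ p ^ (e * n + e - e) * ofRoot b : A) • m)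
      rw [Nat.add_sub_cancel, mul_smul]

/-- One application of γ pushes the extension of σ_m up to the extension of σ_{m+1} at level (n +
1)e. As m + 1 ≤ n, that ideal is already extended from level ne, so `Ψ` brings it back there. -/
theorem image_gamma_le {n m : ℕ} (h : m ≤ n) :
    (φ.gamma Ψ n).image m ≤ (φ.image m).map (levelUp p A R (Nat.mul_le_mul_left e h)) := by
  induction m with
  | zero => rw [image_zero, Ideal.map_top]; exact le_top
  | succ m ih =>
    rw [CartierMap.image_succ]
    refine Ideal.span_le.2 ?_
    rintro _ ⟨t, ht, x, rfl⟩
    replace ht := ih (by omega) ht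
    induction x using ext_induction with
    | h0 => rw [smul_zero, map_zero]; exact Ideal.zero_mem _
    | ha x y hx hy => rw [smul_add, map_add]; exact Ideal.add_mem _ hx hy
    | ht l x =>
      have h1 := φ.gamma_smul_extTmul Ψ n t l (ofFrob x)
      change (φ.gamma Ψ n).toAddMonoidHom (t • extTmul l x) = _ at h1
      rw [h1]
      have h2 := φ.pair_mem_push l ht
      rw [push_map_levelUp, ← image_succ, ← map_levelUp_map_levelUp
        (j := e * n) (Nat.mul_le_mul_left e h) (Nat.le_add_right _ _)] at h2
      exact baseChange_evalRoot_mem Ψ (ofFrob x) h2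

/-- Uses that `push` consists of sums of values of `pair`, on each of which the map is a value of γ.
-/
theorem baseChange_evalRoot_mem_push {n : ℕ} {J : Ideal (R ⊗[A] Root p (e * n) A)} (m : M)
    {y : R ⊗[A] Root p (e * n + e) A} (hy : y ∈ φ.push (e * n) J) :
    LinearMap.baseChange R (evalRoot Ψ (e * n) m) y ∈ (φ.gamma Ψ n).push J := by
  refine φ.push_induction (motive := fun y =>
    LinearMap.baseChange R (evalRoot Ψ (e * n) m) y ∈ (φ.gamma Ψ n).push J) ?_ ?_ ?_ hy
  · rw [map_zero]; exact Ideal.zero_mem _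
  · intro y y' hy hy'; rw [map_add]; exact Ideal.add_mem _ hy hy'
  · intro l t ht
    rw [← gamma_smul_extTmul]
    exact (φ.gamma Ψ n).map_smul_mem_push ht _

theorem baseChange_evalRoot_levelUp (k : ℕ) {m : M} (hm : Ψ.toAddMonoidHom m = 1)
    (t : R ⊗[A] Root p k A) : LinearMap.baseChange R (evalRoot Ψ k m)
      (levelUp p A R (Nat.le_add_right k e) t) = t := by
  have h1 := baseChange_evalRoot_mul_levelUp (R := R) Ψ k m 1 t
  have h2 : LinearMap.baseChange R (evalRoot Ψ k m) 1 = 1 := by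
    rw [Algebra.TensorProduct.one_def, LinearMap.baseChange_tmul, Algebra.TensorProduct.one_def]
    congr 1
    change Ψ.toAddMonoidHom ((1 : A) • m) = 1
    rw [one_smul, hm]
  rwa [h2, one_mul, one_mul] at h1

/-- By stability t, seen one level higher, lies in `push` of σ_n; the retraction given by Ψ(m) = 1
returns t and lands in γ(σ_n N). -/
theorem image_le_push_gamma {n : ℕ} (h : φ.IsStableAt n) {m : M}
    (hm : Ψ.toAddMonoidHom m = 1) : φ.image n ≤ (φ.gamma Ψ n).push (φ.image n) := by
  intro t ht
  have h1 : levelUp p A R (mul_le_mul_succ e n) t ∈ φ.image (n + 1) := by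
    rw [show φ.image (n + 1) = _ from h]
    exact Ideal.mem_map_of_mem _ ht
  rw [image_succ] at h1
  have h2 := φ.baseChange_evalRoot_mem_push Ψ m h1
  have h3 := baseChange_evalRoot_levelUp Ψ (e * n) hm t
  exact h3 ▸ h2

theorem sigma_gamma_eq {n : ℕ} (h : φ.IsStableAt n) {m : M} (hm : Ψ.toAddMonoidHom m = 1) :
    (φ.gamma Ψ n).sigma = φ.image n := by
  apply le_antisymm
  · refine (iInf_le _ n).trans ((φ.image_gamma_le Ψ le_rfl).trans ?_)
    rw [map_levelUp_self]
  · exact CartierMap.le_sigma _ (φ.image_le_push_gamma Ψ h hm)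

/-! ### Perfect fields -/

section PerfectField

variable {K R L : Type u} [Field K] [CharP K p] [PerfectRing K p] [CommRing R] [Algebra K R]
  [InCharP p R] [AddCommGroup L] [Module K L] [Module R L] [IsScalarTower K R L]
  (φ : RelCartierMap p e K R L)

/-- Every element of K^{1/p^e} comes from K because K is perfect. Together with the injectivity
below, R → R ⊗ K^{1/p^k} is an isomorphism for every k. -/
theorem algebraMap_rid_perfectRoot (t : R ⊗[K] Root p e K) :
    algebraMap R (R ⊗[K] Root p e K) (TensorProduct.AlgebraTensorModule.rid K R R
      (LinearMap.baseChange R (perfectRoot p e K) t)) = t := by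
  induction t with
  | zero => simp only [map_zero]
  | add t t' ht ht' => simp only [map_add, ht, ht']
  | tmul r a =>
    rw [LinearMap.baseChange_tmul, TensorProduct.AlgebraTensorModule.rid_tmul,
      Algebra.TensorProduct.algebraMap_apply, Algebra.algebraMap_self_apply,
      TensorProduct.smul_tmul]
    congr 1
    change ((iterateFrobeniusEquiv K p e).symm (ofRoot a)) ^ p ^ e * 1 = ofRoot a
    rw [mul_one]
    exact (iterateFrobeniusEquiv K p e).apply_symm_apply (ofRoot a)

theorem algebraMap_rootTensor_injective (k : ℕ) :
    Function.Injective (algebraMap R (R ⊗[K] Root p k K)) := by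
  refine Function.LeftInverse.injective (g := fun t => TensorProduct.AlgebraTensorModule.rid K R R
    (LinearMap.baseChange R (perfectRoot p k K) t)) fun r => ?_
  dsimp only
  rw [Algebra.TensorProduct.algebraMap_apply, LinearMap.baseChange_tmul,
    TensorProduct.AlgebraTensorModule.rid_tmul, Algebra.algebraMap_self_apply]
  have h : perfectRoot p k K 1 = 1 := map_one (iterateFrobeniusEquiv K p k).symm
  rw [h, one_smul]

theorem algebraMap_toAbsolute (l : L) :
    algebraMap R (R ⊗[K] Root p e K) (φ.toAbsolute.toAddMonoidHom l) = φ.toAddMonoidHom l :=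
  algebraMap_rid_perfectRoot _

theorem pair_algebraMap (k : ℕ) (l : L) (r : R) :
    φ.pair k l (algebraMap R (R ⊗[K] Root p k K) r) =
      algebraMap R (R ⊗[K] Root p (k + e) K) (φ.toAbsolute.toAddMonoidHom (r • l)) := by
  rw [Algebra.TensorProduct.algebraMap_apply, Algebra.algebraMap_self_apply, pair_tmul,
    ← algebraMap_toAbsolute, AlgHom.commutes]
  exact mul_one _

theorem push_map_algebraMap (k : ℕ) (J : Ideal R) :
    φ.push k (J.map (algebraMap R (R ⊗[K] Root p k K))) =
      (φ.toAbsolute.push J).map (algebraMap R (R ⊗[K] Root p (k + e) K)) := by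
  apply le_antisymm
  · refine Ideal.span_le.2 ?_
    rintro _ ⟨l, t, ht, rfl⟩
    refine φ.pair_mem_of_mem_span ?_ l ht
    rintro l _ ⟨r, hr, rfl⟩
    rw [pair_algebraMap]
    exact Ideal.mem_map_of_mem _ (φ.toAbsolute.map_smul_mem_push hr l)
  · refine Ideal.map_le_iff_le_comap.2 (Ideal.span_le.2 ?_)
    rintro _ ⟨r, hr, l, rfl⟩
    change algebraMap R (R ⊗[K] Root p (k + e) K) _ ∈ φ.push k _
    rw [← pair_algebraMap]
    exact φ.pair_mem_push l (Ideal.mem_map_of_mem _ hr)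

theorem image_eq_map_toAbsolute (n : ℕ) :
    φ.image n = (φ.toAbsolute.image n).map (algebraMap R (R ⊗[K] Root p (e * n) K)) := by
  induction n with
  | zero => rw [image_zero, CartierMap.image_zero, Ideal.map_top]
  | succ n ih => rw [image_succ, ih, push_map_algebraMap, CartierMap.image_succ]; rfl

theorem map_algebraMap_levelUp {j k : ℕ} (h : j ≤ k) (J : Ideal R) :
    (J.map (algebraMap R (R ⊗[K] Root p j K))).map (levelUp p K R h) =
      J.map (algebraMap R (R ⊗[K] Root p k K)) := by
  change (J.map _).map (levelUp p K R h).toRingHom = _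
  rw [Ideal.map_map]
  congr 1
  exact (levelUp p K R h).comp_algebraMap

theorem map_algebraMap_injective (k : ℕ) :
    Function.Injective fun J : Ideal R => J.map (algebraMap R (R ⊗[K] Root p k K)) := by
  have h : Function.Bijective (algebraMap R (R ⊗[K] Root p k K)) :=
    ⟨algebraMap_rootTensor_injective k, fun t => ⟨_, algebraMap_rid_perfectRoot t⟩⟩
  refine Function.LeftInverse.injective
    (g := fun I => I.comap (algebraMap R (R ⊗[K] Root p k K))) fun J => ?_
  exact Ideal.comap_map_of_bijective _ h

/-- The isomorphisms R ≅ R ⊗ K^{1/p^k} are compatible with change of level. This converts the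
condition defining n₀ into relative stability over the perfect generic point. -/
theorem isStableAt_iff_toAbsolute (n : ℕ) :
    φ.IsStableAt n ↔ φ.toAbsolute.image (n + 1) = φ.toAbsolute.image n := by
  rw [IsStableAt, image_eq_map_toAbsolute, image_eq_map_toAbsolute, map_algebraMap_levelUp]
  exact (map_algebraMap_injective _).eq_iff

theorem map_sigma_toAbsolute {n : ℕ} (h : φ.IsStableAt n) :
    φ.toAbsolute.sigma.map (algebraMap R (R ⊗[K] Root p (e * n) K)) = φ.image n := by
  rw [image_eq_map_toAbsolute, φ.toAbsolute.sigma_eq_image]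
  exact fun m hm => (φ.isStableAt_iff_toAbsolute m).1 (h.of_le hm)

end PerfectField

end RelCartierMap

/-! ### Spreading out from the generic point -/

theorem exists_ringHom_tensorProduct {A R B T : Type*} [CommRing A] [CommRing R] [CommRing B]
    [CommRing T] [Algebra A R] [Algebra A B] (β : R →+* T) (α : B →+* T)
    (h : ∀ a, β (algebraMap A R a) = α (algebraMap A B a)) :
    ∃ χ : R ⊗[A] B →+* T, ∀ r b, χ (r ⊗ₜ b) = β r * α b := by
  let : Algebra A T := (β.comp (algebraMap A R)).toAlgebra
  let β' : R →ₐ[A] T := { β with commutes' := fun _ => rfl }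
  let α' : B →ₐ[A] T := { α with commutes' := fun a => (h a).symm }
  exact ⟨(Algebra.TensorProduct.lift β' α' (fun _ _ => Commute.all _ _)).toRingHom, fun r b => rfl⟩

theorem flat_of_injective_algebraMap {A K : Type*} [CommRing A] [IsDomain A] [Field K]
    [Algebra A K] (hK : Function.Injective (algebraMap A K)) : Module.Flat A K := by
  have : FaithfulSMul A K := (faithfulSMul_iff_algebraMap_injective A K).2 hK
  let : Algebra (FractionRing A) K := FractionRing.liftAlgebra A K
  have : Module.Flat A (FractionRing A) := IsLocalization.flat _ (nonZeroDivisors A)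
  exact Module.Flat.trans A (FractionRing A) K

/-- Otherwise a ↦ a q embeds A into Q, and by flatness K embeds into K ⊗ Q with 1 ↦ 1 ⊗ q = 0. -/
theorem exists_ne_zero_smul_eq_zero {A K Q : Type*} [CommRing A] [CommRing K] [Nontrivial K]
    [Algebra A K] [Module.Flat A K] [AddCommGroup Q] [Module A Q] {q : Q}
    (hq : (1 : K) ⊗ₜ[A] q = 0) : ∃ a : A, a ≠ 0 ∧ a • q = 0 := by
  by_contra! H
  have hinj : Function.Injective (LinearMap.toSpanSingleton A Q q) :=
    (injective_iff_map_eq_zero _).2 fun a ha => by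
      by_contra h
      exact H a h ha
  have h2 := Module.Flat.lTensor_preserves_injective_linearMap (M := K) _ hinj
  have h3 : (1 : K) ⊗ₜ[A] (1 : A) = 0 := h2 (by simp [hq])
  have h4 := congrArg (TensorProduct.rid A K) h3
  simp at h4

/-! ### Ideal membership after base change to a field or to a localization. -/

section BaseRingMap

variable {p : ℕ} [Fact p.Prime] {A R : Type u} [CommRing A] [InCharP p A] [CommRing R]
  [Algebra A R]

/-- The target of `baseRingMap` is also the base change of R ⊗ A^{1/p^k} along A^{1/p^k} →
K^{1/p^k}; only the existence half of that universal property is needed. -/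
theorem exists_ringHom_baseRingMap {K T : Type u} [CommRing K] [InCharP p K] [Algebra A K]
    [CommRing T] {k : ℕ} (κ : Root p k K →+* T) (ρ : R ⊗[A] Root p k A →+* T)
    (h : ∀ a, ρ (1 ⊗ₜ a) = κ (rootMap p k (algebraMap A K) a)) :
    ∃ χ : (K ⊗[A] R) ⊗[K] Root p k K →+* T, ∀ s, χ (baseRingMap p k A R K s) = ρ s := by
  have h1 : ∀ a, (κ.comp (algebraMap K (Root p k K))) (algebraMap A K a) =
      (ρ.comp (algebraMap R (R ⊗[A] Root p k A))) (algebraMap A R a) := fun a => by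
    have h2 : algebraMap R (R ⊗[A] Root p k A) (algebraMap A R a) =
        1 ⊗ₜ algebraMap A (Root p k A) a := Algebra.TensorProduct.tmul_one_eq_one_tmul a
    rw [RingHom.comp_apply, RingHom.comp_apply, h2, h]
    congr 1
    exact (map_pow (algebraMap A K) a _).symm
  obtain ⟨χ₁, hχ₁⟩ := exists_ringHom_tensorProduct _ _ h1
  have h2 : ∀ x, χ₁ (algebraMap K (K ⊗[A] R) x) = κ (algebraMap K (Root p k K) x) := fun x => by
    rw [Algebra.TensorProduct.algebraMap_apply, hχ₁, map_one, mul_one]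
    rfl
  obtain ⟨χ, hχ⟩ := exists_ringHom_tensorProduct _ _ h2
  refine ⟨χ, fun s => ?_⟩
  induction s with
  | zero => simp only [map_zero]
  | add s t hs ht => simp only [map_add, hs, ht]
  | tmul r a =>
    rw [baseRingMap, relRingMap_tmul, hχ]
    change χ₁ (1 ⊗ₜ r) * κ (rootMap p k (algebraMap A K) a) = _
    rw [hχ₁, ← h, map_one, one_mul, RingHom.comp_apply, ← map_mul,
      Algebra.TensorProduct.algebraMap_apply, Algebra.TensorProduct.tmul_mul_tmul, mul_one, one_mul]
    rfl

/-- With Q the quotient by J, the base-changed ring maps to K^{1/p^k} ⊗ Q and kills the extension of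
J. So the class of x vanishes there, and is torsion over A^{1/p^k}. -/
theorem exists_mul_mem_of_baseRingMap_mem [IsDomain A] {K : Type u} [Field K] [InCharP p K]
    [Algebra A K] (hK : Function.Injective (algebraMap A K)) {k : ℕ}
    {J : Ideal (R ⊗[A] Root p k A)} {x : R ⊗[A] Root p k A}
    (hx : baseRingMap p k A R K x ∈ J.map (baseRingMap p k A R K)) :
    ∃ a : A, a ≠ 0 ∧ ((1 : R) ⊗ₜ[A] toRoot p k a) * x ∈ J := by
  let : Algebra (Root p k A) (Root p k K) := (rootMap p k (algebraMap A K)).toAlgebra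
  let : Algebra (Root p k A) ((R ⊗[A] Root p k A) ⧸ J) :=
    ((Ideal.Quotient.mk J).comp (Algebra.TensorProduct.includeRight :
      Root p k A →ₐ[A] R ⊗[A] Root p k A).toRingHom).toAlgebra
  obtain ⟨χ, hχ⟩ := exists_ringHom_baseRingMap (K := K) (T := Root p k K ⊗[Root p k A]
      ((R ⊗[A] Root p k A) ⧸ J))
    (algebraMap (Root p k K) _)
    ((Algebra.TensorProduct.includeRight :
      ((R ⊗[A] Root p k A) ⧸ J) →ₐ[Root p k A] _).toRingHom.comp (Ideal.Quotient.mk J)) (fun a => by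
        exact (Algebra.TensorProduct.tmul_one_eq_one_tmul (R := Root p k A) (A := Root p k K)
          (B := (R ⊗[A] Root p k A) ⧸ J) a).symm)
  have h1 : χ (baseRingMap p k A R K x) = 0 := by
    have h2 : J.map (baseRingMap p k A R K) ≤ RingHom.ker χ := by
      refine Ideal.map_le_iff_le_comap.2 fun y hy => ?_
      change χ _ = 0
      rw [hχ, RingHom.comp_apply, Ideal.Quotient.eq_zero_iff_mem.2 hy, map_zero]
    exact h2 hx
  rw [hχ] at h1
  have : Nontrivial (Root p k K) := inferInstanceAs (Nontrivial K)
  have : Module.Flat (Root p k A) (Root p k K) :=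
    @flat_of_injective_algebraMap A K _ _ _ (algebraMap A K).toAlgebra hK
  obtain ⟨a, ha, h2⟩ := exists_ne_zero_smul_eq_zero (A := Root p k A) (K := Root p k K)
    (q := Ideal.Quotient.mk J x) h1
  refine ⟨ofRoot a, ha, ?_⟩
  rw [Algebra.smul_def] at h2
  exact Ideal.Quotient.eq_zero_iff_mem.1 ((map_mul (Ideal.Quotient.mk J) _ _).trans h2)

theorem isNoetherianRing_tensor_root [IsNoetherianRing A] [Algebra.FiniteType A R] (k : ℕ) :
    IsNoetherianRing (R ⊗[A] Root p k A) := by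
  have : IsNoetherianRing (Root p k A) := inferInstanceAs (IsNoetherianRing A)
  have : IsNoetherianRing (Root p k A ⊗[A] R) :=
    Algebra.FiniteType.isNoetherianRing (Root p k A) _
  exact isNoetherianRing_of_ringEquiv _ (Algebra.TensorProduct.comm A (Root p k A) R).toRingEquiv

theorem exists_mul_mem_of_map_baseRingMap_le [IsDomain A] {K : Type u} [Field K] [InCharP p K]
    [Algebra A K] (hK : Function.Injective (algebraMap A K)) [IsNoetherianRing A]
    [Algebra.FiniteType A R] {k : ℕ} {I J : Ideal (R ⊗[A] Root p k A)}
    (h : I.map (baseRingMap p k A R K) ≤ J.map (baseRingMap p k A R K)) :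
    ∃ a : A, a ≠ 0 ∧ ∀ x ∈ I, ((1 : R) ⊗ₜ[A] toRoot p k a) * x ∈ J := by
  have := isNoetherianRing_tensor_root (p := p) (A := A) (R := R) k
  obtain ⟨s, rfl⟩ := (isNoetherianRing_iff_ideal_fg _).1 this I
  have h1 : ∀ x ∈ s, ∃ a : A, a ≠ 0 ∧ ((1 : R) ⊗ₜ[A] toRoot p k a) * x ∈ J := fun x hx =>
    exists_mul_mem_of_baseRingMap_mem hK (h (Ideal.mem_map_of_mem _ (Ideal.subset_span hx)))
  choose! a ha h2 using h1
  -- J-membership persists under multiples, so one product serves all the finitely many generators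
  -- of I.
  refine ⟨∏ x ∈ s, a x, Finset.prod_ne_zero_iff.2 ha, fun x hx => ?_⟩
  induction hx using Submodule.span_induction with
  | mem x hx =>
    obtain ⟨b, hb⟩ := Finset.dvd_prod_of_mem a hx
    have h3 : ((1 : R) ⊗ₜ[A] toRoot p k (∏ x ∈ s, a x)) =
        ((1 : R) ⊗ₜ[A] toRoot p k b) * ((1 : R) ⊗ₜ[A] toRoot p k (a x)) := by
      rw [Algebra.TensorProduct.tmul_mul_tmul, one_mul, hb, mul_comm]
      rfl
    rw [h3, mul_assoc]
    exact Ideal.mul_mem_left _ _ (h2 x hx)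
  | zero => rw [mul_zero]; exact Ideal.zero_mem _
  | add x y _ _ hx hy => rw [mul_add]; exact Ideal.add_mem _ hx hy
  | smul s x _ hx => rw [smul_eq_mul, mul_left_comm]; exact Ideal.mul_mem_left _ _ hx

/-- If `R'` is the localization of `R` at `h`, membership in an ideal after base change to `R'`
holds up to a power of `h`. -/
theorem exists_pow_smul_mem {A' R' : Type u} [CommRing A'] [InCharP p A'] [CommRing R']
    [Algebra A' R'] (g : A →+* A') (hg : Function.Bijective g) (q : R →+* R')
    (hgq : q.comp (algebraMap A R) = (algebraMap A' R').comp g) (h : R)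
    (hloc : letI := q.toAlgebra; IsLocalization.Away h R') {k : ℕ}
    {J : Ideal (R ⊗[A] Root p k A)} {y : R ⊗[A] Root p k A}
    (hy : relRingMap p k g q hgq y ∈ J.map (relRingMap p k g q hgq)) :
    ∃ N : ℕ, h ^ N • y ∈ J := by
  let := q.toAlgebra
  have : IsLocalization.Away h R' := hloc
  -- In T, the localization of Q at the class of h, that class is a unit; as g is bijective, R' ⊗
  -- A'^{1/p^k} maps to T. The element y then dies in T, that is, a power of h kills it in Q.
  let Q := (R ⊗[A] Root p k A) ⧸ J
  let c : R →+* Q := (Ideal.Quotient.mk J).comp (algebraMap R (R ⊗[A] Root p k A))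
  let T := Localization.Away (c h)
  let β₀ : R →+* T := (algebraMap Q T).comp c
  have hu : IsUnit (β₀ h) := IsLocalization.Away.algebraMap_isUnit (c h)
  let β : R' →+* T := IsLocalization.Away.lift h hu
  have hβ : ∀ r, β (q r) = β₀ r := fun r => IsLocalization.Away.lift_eq h hu r
  let α₀ : Root p k A →+* T := (algebraMap Q T).comp ((Ideal.Quotient.mk J).comp
    (Algebra.TensorProduct.includeRight : Root p k A →ₐ[A] R ⊗[A] Root p k A).toRingHom)
  let α : Root p k A' →+* T := α₀.comp
    (rootMap p k ((RingEquiv.ofBijective g hg).symm : A' →+* A))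
  have hα : ∀ a : A, α (toRoot p k (g a)) = α₀ (toRoot p k a) := fun a =>
    congrArg (fun b : A => α₀ (toRoot p k b)) ((RingEquiv.ofBijective g hg).symm_apply_apply a)
  obtain ⟨χ, hχ⟩ := exists_ringHom_tensorProduct (A := A') β α (fun a' => by
    obtain ⟨a, rfl⟩ := hg.2 a'
    have h1 : algebraMap A' R' (g a) = q (algebraMap A R a) := (RingHom.congr_fun hgq a).symm
    have h2 : algebraMap A' (Root p k A') (g a) = toRoot p k (g (a ^ p ^ k)) :=
      (map_pow g a _).symm
    rw [h1, h2, hβ, hα]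
    change algebraMap Q T (Ideal.Quotient.mk J (algebraMap R _ (algebraMap A R a))) =
      algebraMap Q T (Ideal.Quotient.mk J ((1 : R) ⊗ₜ[A] algebraMap A (Root p k A) a))
    exact congrArg (fun z => algebraMap Q T (Ideal.Quotient.mk J z))
      (Algebra.TensorProduct.tmul_one_eq_one_tmul a))
  have hχ' : ∀ s, χ (relRingMap p k g q hgq s) = algebraMap Q T (Ideal.Quotient.mk J s) :=
    fun s => by
      induction s with
      | zero => simp only [map_zero]
      | add s t hs ht => simp only [map_add, hs, ht]
      | tmul r a =>
        rw [relRingMap_tmul, hχ, hβ, hα]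
        change algebraMap Q T (Ideal.Quotient.mk J (algebraMap R _ r)) *
          algebraMap Q T (Ideal.Quotient.mk J ((1 : R) ⊗ₜ[A] a)) = _
        rw [← map_mul, ← map_mul, Algebra.TensorProduct.algebraMap_apply,
          Algebra.algebraMap_self_apply, Algebra.TensorProduct.tmul_mul_tmul, mul_one, one_mul]
  have h1 : algebraMap Q T (Ideal.Quotient.mk J y) = 0 := by
    rw [← hχ']
    have h2 : J.map (relRingMap p k g q hgq) ≤ RingHom.ker χ := by
      refine Ideal.map_le_iff_le_comap.2 fun y hy => ?_
      change χ _ = 0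
      rw [hχ', Ideal.Quotient.eq_zero_iff_mem.2 hy, map_zero]
    exact h2 hy
  obtain ⟨⟨_, N, rfl⟩, hN⟩ := (IsLocalization.map_eq_zero_iff (Submonoid.powers (c h)) T _).1 h1
  refine ⟨N, ?_⟩
  rw [Algebra.smul_def, ← Ideal.Quotient.eq_zero_iff_mem, map_mul, map_pow, map_pow]
  exact hN

end BaseRingMap

/-! ### Spreading stability out, and checking it on localizations of R. -/

namespace RelCartierMap

variable {p e : ℕ} [Fact p.Prime] {A R L : Type u} [CommRing A] [InCharP p A]
    [CommRing R] [InCharP p R] [Algebra A R] [AddCommGroup L] [Module A L] [Module R L]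
    [IsScalarTower A R L] {φ : RelCartierMap p e A R L}

theorem isStableAt_of_map_le {n : ℕ}
    (h : (φ.image n).map (levelUp p A R (mul_le_mul_succ e n)) ≤ φ.image (n + 1)) :
    φ.IsStableAt n :=
  le_antisymm (φ.image_succ_le n) h

/-- If the images of the iterates are stable on a fibre over a field containing `A`, they are
stable up to multiplication by a nonzero element of `A`. -/
theorem exists_mul_mem_of_isStableAt_baseChange [IsDomain A] {K : Type u} [Field K] [InCharP p K]
    [Algebra A K] (hK : Function.Injective (algebraMap A K)) [IsNoetherianRing A]
    [Algebra.FiniteType A R] {n : ℕ} (h : (φ.baseChange K).IsStableAt n) :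
    ∃ a : A, a ≠ 0 ∧ ∀ x ∈ (φ.image n).map (levelUp p A R (mul_le_mul_succ e n)),
      ((1 : R) ⊗ₜ[A] toRoot p (e * (n + 1)) a) * x ∈ φ.image (n + 1) := by
  refine exists_mul_mem_of_map_baseRingMap_le hK ?_
  rw [← image_baseChange, show (φ.baseChange K).image (n + 1) = _ from h, image_baseChange]
  exact (map_relRingMap_levelUp _ _ _ _ _).le

variable {A' R' L' : Type u} [CommRing A'] [InCharP p A'] [CommRing R'] [InCharP p R']
  [Algebra A' R'] [AddCommGroup L'] [Module A' L'] [Module R' L'] [IsScalarTower A' R' L']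
  {φ' : RelCartierMap p e A' R' L'}

theorem IsGeneratingMap.isStableAt_of_isUnit {g : A →+* A'} {h : R →+* R'}
    {hgh : h.comp (algebraMap A R) = (algebraMap A' R').comp g} {q : L →+ L'}
    (H : IsGeneratingMap φ φ' g h hgh q) {n : ℕ} {a : A} (ha : IsUnit (g a))
    (hn : ∀ x ∈ (φ.image n).map (levelUp p A R (mul_le_mul_succ e n)),
      ((1 : R) ⊗ₜ[A] toRoot p (e * (n + 1)) a) * x ∈ φ.image (n + 1)) :
    φ'.IsStableAt n := by
  apply isStableAt_of_map_le
  rw [H.image_eq, H.image_eq, ← map_relRingMap_levelUp]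
  refine Ideal.map_le_iff_le_comap.2 fun x hx => ?_
  have h1 := Ideal.mem_map_of_mem (relRingMap p (e * (n + 1)) g h hgh) (hn x hx)
  rw [map_mul, relRingMap_tmul, map_one] at h1
  refine ((Ideal.unit_mul_mem_iff_mem (Ideal.map (relRingMap p (e * (n + 1)) g h hgh)
    (φ.image (n + 1))) ?_).1 h1)
  exact ha.map (Algebra.TensorProduct.includeRight :
    Root p (e * (n + 1)) A' →ₐ[A'] R' ⊗[A'] Root p (e * (n + 1)) A')

theorem IsGeneratingMap.exists_pow_smul_mem {g : A →+* A'} {h : R →+* R'}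
    {hgh : h.comp (algebraMap A R) = (algebraMap A' R').comp g} {q : L →+ L'}
    (H : IsGeneratingMap φ φ' g h hgh q) (hg : Function.Bijective g) (r : R)
    (hloc : letI := h.toAlgebra; IsLocalization.Away r R') {n : ℕ} (hn : φ'.IsStableAt n)
    {x : R ⊗[A] Root p (e * (n + 1)) A}
    (hx : x ∈ (φ.image n).map (levelUp p A R (mul_le_mul_succ e n))) :
    ∃ N : ℕ, r ^ N • x ∈ φ.image (n + 1) := by
  refine RelFrob.exists_pow_smul_mem g hg h hgh r hloc ?_
  rw [← H.image_eq, show φ'.image (n + 1) = _ from hn, H.image_eq, ← map_relRingMap_levelUp]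
  exact Ideal.mem_map_of_mem _ hx

/-- For fixed x, the r ∈ R with r x in the smaller image form an ideal. Its radical contains s, so
it is the unit ideal. -/
theorem isStableAt_of_forall_exists_pow {n : ℕ} (s : Set R) (hs : Ideal.span s = ⊤)
    (h : ∀ r ∈ s, ∀ x ∈ (φ.image n).map (levelUp p A R (mul_le_mul_succ e n)),
      ∃ N : ℕ, r ^ N • x ∈ φ.image (n + 1)) : φ.IsStableAt n := by
  refine isStableAt_of_map_le fun x hx => ?_
  let I : Ideal R := ((φ.image (n + 1)).restrictScalars R).comap (LinearMap.toSpanSingleton R _ x)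
  have h1 : I.radical = ⊤ := top_le_iff.1 (hs ▸ Ideal.span_le.2 fun r hr => h r hr x hx)
  have h2 : (1 : R) ∈ I := by rw [Ideal.radical_eq_top.1 h1]; trivial
  simpa [I] using h2

end RelCartierMap

/-! ### Sections of line bundles over affine open sets -/

/-- Restriction of functions. -/
def funRes {X : Scheme.{u}} {U' U : X.Opens} (h : U' ≤ U) : Γ(X, U) →+* Γ(X, U') :=
  (X.presheaf.map (homOfLE h).op).hom

/-- Restriction of sections of a sheaf of modules. -/
def secRes {X : Scheme.{u}} (L : X.Modules) {U' U : X.Opens} (h : U' ≤ U) :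
    Γ(L, U) →+ Γ(L, U') :=
  (L.presheaf.map (homOfLE h).op).hom

section Sections

variable {X : Scheme.{u}} {L : X.Modules} {U U' U'' : X.Opens}

theorem funRes_funRes (h : U' ≤ U) (h' : U'' ≤ U') (r : Γ(X, U)) :
    funRes h' (funRes h r) = funRes (h'.trans h) r := by
  change (X.presheaf.map _ ≫ X.presheaf.map _).hom r = _
  rw [← X.presheaf.map_comp]
  rfl

theorem secRes_secRes (h : U' ≤ U) (h' : U'' ≤ U') (l : Γ(L, U)) :
    secRes L h' (secRes L h l) = secRes L (h'.trans h) l := by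
  change (L.presheaf.map _ ≫ L.presheaf.map _).hom l = _
  rw [← L.presheaf.map_comp]
  rfl

theorem secRes_self (l : Γ(L, U)) : secRes L le_rfl l = l := by
  change (L.presheaf.map (𝟙 _)).hom l = l
  rw [L.presheaf.map_id]
  rfl

theorem secRes_smul (h : U' ≤ U) (r : Γ(X, U)) (l : Γ(L, U)) :
    secRes L h (r • l) = funRes h r • secRes L h l :=
  L.map_smul _ r l

theorem secRes_ext {ι : Type u} (D : ι → X.Opens) (hD : ∀ i, D i ≤ U) (hcover : U ≤ iSup D)
    {l l' : Γ(L, U)} (h : ∀ i, secRes L (hD i) l = secRes L (hD i) l') : l = l' :=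
  TopCat.Sheaf.eq_of_locally_eq' ⟨L.presheaf, L.isSheaf⟩ D U (fun i => homOfLE (hD i)) hcover l l' h

theorem exists_secRes_eq {ι : Type u} (D : ι → X.Opens) (hD : ∀ i, D i ≤ U) (hcover : U ≤ iSup D)
    (l : ∀ i, Γ(L, D i)) (h : ∀ i j, secRes L (inf_le_left : D i ⊓ D j ≤ D i) (l i) =
      secRes L (inf_le_right : D i ⊓ D j ≤ D j) (l j)) :
    ∃ s : Γ(L, U), ∀ i, secRes L (hD i) s = l i :=
  (TopCat.Sheaf.existsUnique_gluing' ⟨L.presheaf, L.isSheaf⟩ D U (fun i => homOfLE (hD i)) hcover l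
    h).exists

/-- The section `s` trivializes `L` over `U`. -/
def Trivializes (L : X.Modules) (s : Γ(L, U)) : Prop :=
  ∀ (U' : X.Opens) (h : U' ≤ U), Function.Bijective fun r : Γ(X, U') => r • secRes L h s

theorem Trivializes.secRes {s : Γ(L, U)} (hs : Trivializes L s) (h : U' ≤ U) :
    Trivializes L (secRes L h s) := fun U'' h' => by
  simp only [secRes_secRes]
  exact hs U'' _

/-- The open set E is a variable so that intersections such as D(g) ∩ D(h) can be recognized as
basic open sets. -/
theorem isLocalization_funRes (hU : IsAffineOpen U) (h : Γ(X, U)) {E : X.Opens}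
    (hE : X.basicOpen h = E) (hEU : E ≤ U) :
    letI := (funRes hEU).toAlgebra
    IsLocalization.Away h Γ(X, E) := by
  subst hE
  exact hU.isLocalization_basicOpen h

/-- A trivialization reduces this to functions. Having all large exponents allows a common one for
finitely many open sets. -/
theorem Trivializes.eventually_exists_pow_smul {s : Γ(L, U)} (hs : Trivializes L s)
    (hU : IsAffineOpen U) (h : Γ(X, U)) {E : X.Opens} (hE : X.basicOpen h = E) (hEU : E ≤ U)
    (l' : Γ(L, E)) :
    ∀ᶠ N in Filter.atTop, ∃ l : Γ(L, U), RelFrob.secRes L hEU l = funRes hEU h ^ N • l' := by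
  let : Algebra Γ(X, U) Γ(X, E) := (funRes hEU).toAlgebra
  have := isLocalization_funRes hU h hE hEU
  obtain ⟨r', rfl⟩ := (hs E hEU).2 l'
  obtain ⟨N, r, hr⟩ := IsLocalization.Away.surj h r'
  filter_upwards [Filter.eventually_ge_atTop N] with M hM
  obtain ⟨M, rfl⟩ := Nat.exists_eq_add_of_le hM
  refine ⟨(h ^ M * r) • s, ?_⟩
  rw [secRes_smul, map_mul, ← show _ = funRes hEU r from hr, smul_smul, map_pow, pow_add]
  congr 1
  change _ * (_ * funRes hEU h ^ N) = _
  ring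

theorem Trivializes.eventually_pow_smul_eq_zero {s : Γ(L, U)} (hs : Trivializes L s)
    (hU : IsAffineOpen U) (h : Γ(X, U)) {E : X.Opens} (hE : X.basicOpen h = E) (hEU : E ≤ U)
    {l : Γ(L, U)} (hl : RelFrob.secRes L hEU l = 0) :
    ∀ᶠ N in Filter.atTop, h ^ N • l = 0 := by
  let : Algebra Γ(X, U) Γ(X, E) := (funRes hEU).toAlgebra
  have := isLocalization_funRes hU h hE hEU
  obtain ⟨r, hr⟩ := (hs U le_rfl).2 l
  dsimp only at hr
  rw [secRes_self] at hr
  subst hr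
  rw [secRes_smul] at hl
  have h1 : algebraMap Γ(X, U) Γ(X, E) r = 0 := (hs E hEU).1 (hl.trans (zero_smul _ _).symm)
  obtain ⟨⟨_, N, rfl⟩, hN⟩ := (IsLocalization.map_eq_zero_iff (Submonoid.powers h) Γ(X, E) _).1 h1
  filter_upwards [Filter.eventually_ge_atTop N] with M hM
  obtain ⟨M, rfl⟩ := Nat.exists_eq_add_of_le hM
  dsimp only at hN
  rw [smul_smul, pow_add, mul_assoc, mul_left_comm, hN, mul_zero, zero_smul]

/-- Up to a power of `h`, sections of a line bundle over `D(h)` extend. -/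
theorem IsLineBundle.exists_pow_smul_eq (hL : IsLineBundle L) (hU : IsAffineOpen U) (h : Γ(X, U))
    {E : X.Opens} (hE : X.basicOpen h = E) (hEU : E ≤ U) (l' : Γ(L, E)) :
    ∃ (N : ℕ) (l : Γ(L, U)), secRes L hEU l = funRes hEU h ^ N • l' := by
  obtain ⟨t, hG, ht⟩ : ∃ t : Finset Γ(X, U), (∀ g ∈ t, ∃ s : Γ(L, X.basicOpen g),
      Trivializes L s) ∧ Ideal.span (t : Set Γ(X, U)) = ⊤ := by
    have h1 : Ideal.span {g : Γ(X, U) | ∃ s : Γ(L, X.basicOpen g), Trivializes L s} = ⊤ := by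
      rw [← hU.self_le_iSup_basicOpen_iff]
      intro x hx
      obtain ⟨O, hxO, s, hs⟩ := hL x
      obtain ⟨g, hg, hxg⟩ := hU.exists_basicOpen_le ⟨x, hxO⟩ hx
      exact Opens.mem_iSup.2 ⟨⟨g, secRes L hg s, Trivializes.secRes (s := s) hs hg⟩, hxg⟩
    obtain ⟨t, ht, ht'⟩ := (Ideal.span_eq_top_iff_finite _).1 h1
    exact ⟨t, fun g hg => ht hg, ht'⟩
  choose s hs using fun g : t => hG g.1 g.2
  let D : t → X.Opens := fun g => X.basicOpen g.1
  have hD : ∀ g, D g ≤ U := fun g => X.basicOpen_le g.1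
  have hcover : U ≤ iSup D := hU.self_le_iSup_basicOpen_iff.2 ht
  have hDE : ∀ {W : X.Opens} (hW : W ≤ U), X.basicOpen (funRes hW h) = W ⊓ E := fun hW => by
    rw [← hE]
    exact X.basicOpen_res h (homOfLE hW).op
  -- Extend the section on each trivializing D(g) with a common power of h. The extensions agree
  -- only on D(h), so a further power is needed to kill their differences on overlaps before gluing.
  have h1 : ∀ g : t, ∀ᶠ N in Filter.atTop, ∃ l : Γ(L, D g), secRes L inf_le_left l =
      funRes inf_le_left (funRes (hD g) h) ^ N • secRes L (inf_le_right : D g ⊓ E ≤ E) l' :=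
    fun g => (hs g).eventually_exists_pow_smul (hU.basicOpen g.1) _ (hDE (hD g)) inf_le_left _
  obtain ⟨N, hN⟩ := (Filter.eventually_all.2 h1).exists
  choose l hl using hN
  have h2 : ∀ g g' : t, ∀ᶠ N in Filter.atTop,
      funRes (inf_le_left.trans (hD g) : D g ⊓ D g' ≤ U) h ^ N •
        (secRes L (inf_le_left : D g ⊓ D g' ≤ D g) (l g) - secRes L inf_le_right (l g')) = 0 := by
    intro g g'
    have haff : IsAffineOpen (D g ⊓ D g') := by
      have h3 := hU.basicOpen (g.1 * g'.1)
      rwa [X.basicOpen_mul] at h3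
    refine ((hs g).secRes inf_le_left).eventually_pow_smul_eq_zero haff _ (hDE _) inf_le_left ?_
    rw [map_sub, sub_eq_zero, secRes_secRes, secRes_secRes]
    have h3 := congrArg (secRes L (inf_le_inf_right E inf_le_left :
      (D g ⊓ D g') ⊓ E ≤ D g ⊓ E)) (hl g)
    have h4 := congrArg (secRes L (inf_le_inf_right E inf_le_right :
      (D g ⊓ D g') ⊓ E ≤ D g' ⊓ E)) (hl g')
    simp only [secRes_secRes, secRes_smul, map_pow, funRes_funRes] at h3 h4
    rw [h3, h4]
  obtain ⟨N', hN'⟩ := (Filter.eventually_all.2 fun g => Filter.eventually_all.2 (h2 g)).exists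
  obtain ⟨l₀, hl₀⟩ := exists_secRes_eq D hD hcover (fun g => funRes (hD g) h ^ N' • l g)
    (fun g g' => by
      have h3 := hN' g g'
      rw [smul_sub, sub_eq_zero] at h3
      simpa only [secRes_smul, map_pow, funRes_funRes] using h3)
  refine ⟨N' + N, l₀, ?_⟩
  refine secRes_ext (fun g : t => D g ⊓ E) (fun g => inf_le_right) ?_ fun g => ?_
  · rw [← iSup_inf_eq]
    exact le_inf (hEU.trans hcover) le_rfl
  · have h3 := congrArg (secRes L (inf_le_left : D g ⊓ E ≤ D g)) (hl₀ g)
    rw [secRes_secRes, secRes_smul, hl] at h3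
    rw [secRes_secRes, h3, secRes_smul]
    simp only [map_pow, funRes_funRes]
    rw [smul_smul, pow_add]

end Sections

/-! ### Localization of `p^{-e}`-linear maps -/

section Localization

variable {p : ℕ} [Fact p.Prime] {A B : Type u} [CommRing A] [InCharP p A] [CommRing B]
  [InCharP p B] [Algebra A B] {e : ℕ}

/-- The map `F^e_* A → F^e_* B` as an `A`-linear map. -/
def frobAlgebraMap (p e : ℕ) [Fact p.Prime] (A B : Type u) [CommRing A] [InCharP p A] [CommRing B]
    [Algebra A B] : Frob p e A →ₗ[A] Frob p e B where
  toFun a := toFrob p e (algebraMap A B (ofFrob a))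
  map_add' a b := map_add (algebraMap A B) (ofFrob a) (ofFrob b)
  map_smul' a b := by
    change algebraMap A B (a ^ p ^ e * ofFrob b) = a ^ p ^ e • algebraMap A B (ofFrob b)
    rw [map_mul, Algebra.smul_def]

theorem isLocalizedModule_frobAlgebraMap (S : Submonoid A) [IsLocalization S B] :
    IsLocalizedModule S (frobAlgebraMap p e A B) where
  map_units s := by
    obtain ⟨u, hu⟩ := (IsLocalization.map_units B s).pow (p ^ e)
    rw [Module.End.isUnit_iff]
    have h : ∀ x : B, algebraMap A (Module.End A (Frob p e B)) s x = (u : B) * x := fun x => by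
      rw [hu, ← map_pow]
      exact Algebra.smul_def _ x
    constructor
    · intro x y hxy
      exact u.isUnit.mul_left_cancel ((h x).symm.trans (hxy.trans (h y)))
    · intro x
      exact ⟨toFrob p e (((u⁻¹ : Bˣ) : B) * ofFrob x),
        (h _).trans (u.mul_inv_cancel_left (ofFrob x))⟩
  surj x := by
    obtain ⟨⟨a, s⟩, h⟩ := IsLocalization.surj S (ofFrob x : B)
    -- The scalar s acts as s^{p^e}, so the fraction a / s is rewritten as s^{p^e - 1} a / s^{p^e}.
    refine ⟨⟨toFrob p e ((s : A) ^ (p ^ e - 1) * a), s⟩, ?_⟩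
    change ((s : A) ^ p ^ e) • (ofFrob x : B) = algebraMap A B ((s : A) ^ (p ^ e - 1) * a)
    rw [map_mul, ← h, Algebra.smul_def, ← Nat.sub_add_cancel
      (Nat.one_le_pow e p (Fact.out : p.Prime).pos), pow_succ, Nat.add_sub_cancel, map_mul]
    ring
  exists_of_eq {x y} h := by
    obtain ⟨s, hs⟩ := (IsLocalization.eq_iff_exists S B (x := ofFrob x) (y := ofFrob y)).1 h
    refine ⟨s, ?_⟩
    change ((s : A) ^ p ^ e) * (ofFrob x : A) = (s : A) ^ p ^ e * (ofFrob y : A)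
    rw [← Nat.sub_add_cancel (Nat.one_le_pow e p (Fact.out : p.Prime).pos), pow_succ, mul_assoc, hs,
      mul_assoc]

/-- F^e_* B is the localization of F^e_* A, so θ extends as an A-linear map. Linearity over B is
then automatic: multiply by the denominator of the scalar. -/
theorem CartierMap.exists_localization (S : Submonoid A) [IsLocalization S B]
    (θ : CartierMap p e A A) : ∃ θ' : CartierMap p e B B, ∀ a,
      θ'.toAddMonoidHom (algebraMap A B a) = algebraMap A B (θ.toAddMonoidHom a) := by
  have := isLocalizedModule_frobAlgebraMap (p := p) (e := e) (B := B) S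
  let θ₀ : Frob p e A →ₗ[A] B :=
    { toFun := fun a => algebraMap A B (θ.toAddMonoidHom (ofFrob a))
      map_add' := fun a b => by
        rw [← map_add, ← map_add]
        rfl
      map_smul' := fun a b => by
        rw [RingHom.id_apply, Algebra.smul_def, ← map_mul]
        exact congrArg _ (θ.map_smul' a (ofFrob b)) }
  let θ₁ : Frob p e B →ₗ[A] B := IsLocalizedModule.lift S (frobAlgebraMap p e A B) θ₀
    (fun s => (Module.End.isUnit_iff _).2 (by
      obtain ⟨u, hu⟩ := IsLocalization.map_units B s
      have h : ∀ x : B, algebraMap A (Module.End A B) s x = (u : B) * x := fun x => by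
        rw [hu]
        exact Algebra.smul_def _ x
      constructor
      · intro x y hxy
        rw [h, h] at hxy
        exact u.isUnit.mul_left_cancel hxy
      · intro x
        exact ⟨(((u⁻¹ : Bˣ) : B) * x : B), (h _).trans (u.mul_inv_cancel_left x)⟩))
  have h1 : ∀ a : Frob p e A, θ₁ (frobAlgebraMap p e A B a) = θ₀ a := fun a =>
    IsLocalizedModule.lift_apply S _ _ _ a
  have h2 : ∀ (a : A) (x : B), θ₁ (toFrob p e (algebraMap A B a ^ p ^ e * x)) =
      algebraMap A B a * θ₁ (toFrob p e x) := fun a x => by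
    have h3 := map_smul θ₁ a (toFrob p e x)
    rw [Algebra.smul_def] at h3
    rw [← h3, ← map_pow]
    exact congrArg θ₁ (Algebra.smul_def (a ^ p ^ e) x).symm
  refine ⟨{ toAddMonoidHom := θ₁.toAddMonoidHom, map_smul' := fun b x => ?_ }, fun a => h1 a⟩
  change θ₁ (toFrob p e (b ^ p ^ e * x)) = b * θ₁ (toFrob p e x)
  obtain ⟨⟨a, s⟩, h⟩ := IsLocalization.surj S b
  refine (IsLocalization.map_units B s).mul_left_cancel ?_
  dsimp only at h
  rw [← h2, ← mul_assoc, ← mul_assoc, mul_comm _ b, h, ← h2, ← mul_pow, mul_comm _ b, h]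

/-- A splitting of the Frobenius gives a splitting of its iterates. -/
theorem CartierMap.exists_iterate (θ : CartierMap p 1 A A) (h : θ.toAddMonoidHom 1 = 1) (e : ℕ) :
    ∃ θ' : CartierMap p e A A, θ'.toAddMonoidHom 1 = 1 := by
  induction e with
  | zero => exact ⟨⟨AddMonoidHom.id A, fun s x => by simp⟩, rfl⟩
  | succ e ih =>
    obtain ⟨θ', h'⟩ := ih
    refine ⟨⟨θ.toAddMonoidHom.comp θ'.toAddMonoidHom, fun s x => ?_⟩,
      (congrArg θ.toAddMonoidHom h').trans h⟩
    have h1 : θ'.toAddMonoidHom ((s ^ p ^ 1) ^ p ^ e • x) = s ^ p ^ 1 * θ'.toAddMonoidHom x :=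
      θ'.map_smul' _ x
    rw [← pow_mul, ← pow_add, add_comm 1 e] at h1
    change θ.toAddMonoidHom (θ'.toAddMonoidHom (s ^ p ^ (e + 1) • x)) = _
    rw [h1]
    exact θ.map_smul' s _

end Localization

/-! ### The generic point -/

section Generic

variable {p : ℕ} [Fact p.Prime] {X V : Scheme.{u}} [IsIntegral V] [SchemeCharP p V]

theorem genericPoint_mem {W : V.Opens} (h : (W : Set V).Nonempty) : genericPoint V ∈ W :=
  (genericPoint_spec V).mem_open_set_iff W.2 |>.2 (by simpa using h)

theorem perfectGenericPoint_apply (y : Spec (.of (perfectFunctionField p V))) :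
    perfectGenericPoint p V y = genericPoint V := by
  rw [perfectGenericPoint, Scheme.Hom.comp_apply]
  have h : ∀ z : Spec V.functionField, z = IsLocalRing.closedPoint V.functionField := fun z =>
    Subsingleton.elim (α := PrimeSpectrum V.functionField) _ _
  rw [h (Spec.map _ y)]
  exact Scheme.fromSpecStalk_closedPoint

/-- A function that vanishes at the generic point has a basic open set missing that point, hence
empty, and on an integral scheme it is zero. -/
theorem Chart.evalAt_injective {f : X ⟶ V} (c : Chart f) {K : Type u} [Field K]
    (u : Spec (.of K) ⟶ V) (hu : ⊤ ≤ u ⁻¹ᵁ c.W.1) (hu' : ∀ y, u y = genericPoint V) :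
    Function.Injective (c.evalAt u hu) := by
  refine (injective_iff_map_eq_zero _).2 fun a ha => ?_
  have h1 : (u.appLE c.W.1 ⊤ hu).hom a = 0 :=
    (map_eq_zero_iff _ (Scheme.ΓSpecIso (.of K)).commRingCatIsoToRingEquiv.injective).1 ha
  have h2 := Scheme.basicOpen_appLE u ⊤ c.W.1 hu a
  rw [show (u.appLE c.W.1 ⊤ hu) a = 0 from h1, Scheme.basicOpen_zero, top_inf_eq] at h2
  by_contra h3
  have h4 : genericPoint V ∈ V.basicOpen (show Γ(V, c.W.1) from a) := by
    refine genericPoint_mem ((Opens.ne_bot_iff_nonempty _).1 ?_)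
    exact fun h => h3 ((basicOpen_eq_bot_iff (X := V) _).1 h)
  let y : Spec (.of K) := (⊥ : PrimeSpectrum K)
  have h5 : y ∈ u ⁻¹ᵁ V.basicOpen (show Γ(V, c.W.1) from a) := by
    change u y ∈ V.basicOpen (show Γ(V, c.W.1) from a)
    rwa [hu']
  rw [← h2] at h5
  exact h5

/-- A splitting of Frobenius iterates to one of F^e. Localized to where `M` is trivial, it becomes a
map F^e_* M → 𝒪 with value 1 at the generator of `M`; since it equals Ψ(a · −), a times that
generator is the required section. -/
theorem SheafCartierMap.Generates.exists_eq_one {e : ℕ} (hpure : IsFPure p V) {M : V.Modules}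
    (hM : IsLineBundle M) {Ψ : SheafCartierMap p e V M} (hΨ : Ψ.Generates) :
    ∃ W : V.affineOpens, genericPoint V ∈ W.1 ∧
      ∃ m : Γ(M, W.1), (Ψ.app W).toAddMonoidHom m = 1 := by
  obtain ⟨W, hW, θ, hθ⟩ := hpure (genericPoint V)
  obtain ⟨O, hO, s, hs⟩ := hM (genericPoint V)
  obtain ⟨g, hg, hg'⟩ := W.2.exists_basicOpen_le ⟨_, hO⟩ hW
  refine ⟨⟨V.basicOpen g, W.2.basicOpen g⟩, hg', ?_⟩
  obtain ⟨θe, hθe⟩ := θ.exists_iterate hθ e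
  let : Algebra Γ(V, W.1) Γ(V, V.basicOpen g) := (funRes (V.basicOpen_le g)).toAlgebra
  have : IsLocalization.Away g Γ(V, V.basicOpen g) := isLocalization_funRes W.2 g rfl _
  obtain ⟨θ', hθ'⟩ := θe.exists_localization (B := Γ(V, V.basicOpen g)) (Submonoid.powers g)
  replace hs : Function.Bijective fun r : Γ(V, V.basicOpen g) => r • secRes M hg s := hs _ hg
  let q : Γ(V, V.basicOpen g) ≃ₗ[Γ(V, V.basicOpen g)] Γ(M, V.basicOpen g) :=
    LinearEquiv.ofBijective (LinearMap.toSpanSingleton _ _ (secRes M hg s)) hs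
  obtain ⟨a, ha⟩ := hΨ ⟨V.basicOpen g, W.2.basicOpen g⟩
    ⟨θ'.toAddMonoidHom.comp q.symm.toLinearMap.toAddMonoidHom, fun r m => by
      change θ'.toAddMonoidHom (q.symm (r ^ p ^ e • m)) = r * θ'.toAddMonoidHom (q.symm m)
      rw [map_smul]
      exact θ'.map_smul' r _⟩
  refine ⟨a • q 1, (ha (q 1)).symm.trans ?_⟩
  change θ'.toAddMonoidHom (q.symm (q 1)) = 1
  rw [q.symm_apply_apply, ← map_one (algebraMap Γ(V, W.1) Γ(V, V.basicOpen g)), hθ', hθe]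

end Generic

/-! ### Stability of the images over a dense open set -/

namespace RelSheafCartierMap

variable {p e : ℕ} [Fact p.Prime] {X V : Scheme.{u}} [SchemeCharP p V] {f : X ⟶ V} {L : X.Modules}

theorem isGeneratingMap_res (φ : RelSheafCartierMap p e f L) (hL : IsLineBundle L)
    {c' c : Chart f} (hU : c'.U.1 ≤ c.U.1) (hW : c'.W.1 ≤ c.W.1) (r : Γ(X, c.U.1))
    (hr : X.basicOpen r = c'.U.1) :
    RelCartierMap.IsGeneratingMap (φ.app c) (φ.app c') (Chart.resA hW) (Chart.resR hU)
      (Chart.resR_comp hU hW) (Chart.resSec hU L) where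
  smul r l := secRes_smul hU r l
  comp l := φ.app_res hU hW l
  generates l' := by
    change Γ(L, c'.U.1) at l'
    obtain ⟨N, l, hl⟩ := IsLineBundle.exists_pow_smul_eq hL c.U.2 r hr hU l'
    have hu : IsUnit (funRes hU r) := by
      let : Algebra Γ(X, c.U.1) Γ(X, c'.U.1) := (funRes hU).toAlgebra
      have := isLocalization_funRes c.U.2 r hr hU
      exact IsLocalization.Away.algebraMap_isUnit r
    obtain ⟨v, hv⟩ := hu.exists_left_inv
    -- The section is l / r^N; multiplying top and bottom by r^{N(p^e - 1)} makes the denominator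
    -- the p^e-th power of r^N, as generation over the relative Frobenius requires.
    refine AddSubgroup.subset_closure ⟨v ^ N, 1, (r ^ (N * (p ^ e - 1)) • l : Γ(L, c.U.1)), ?_⟩
    rw [one_smul]
    change (v ^ N) ^ p ^ e • secRes L hU (r ^ (N * (p ^ e - 1)) • l) = l'
    rw [secRes_smul, hl, map_pow, smul_smul, smul_smul]
    have h1 : (v ^ N) ^ p ^ e * funRes hU r ^ (N * (p ^ e - 1)) * funRes hU r ^ N = 1 := by
      have h2 : N * (p ^ e - 1) + N = N * p ^ e := by
        rw [← Nat.mul_succ, Nat.succ_eq_add_one, Nat.sub_add_cancel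
          (Nat.one_le_pow e p (Fact.out : p.Prime).pos)]
      rw [mul_assoc, ← pow_add, h2, ← pow_mul, ← mul_pow, hv, one_pow]
    rw [h1, one_smul]

variable [IsIntegral V] [IsNoetherian V]

/-- On a chart of finite type, the images of the iterates are stable from the uniform integer on,
up to a nonzero function on the base. -/
theorem IsUniformInteger.exists_mul_mem {φ : RelSheafCartierMap p e f L} {n₀ : ℕ}
    (hn₀ : φ.IsUniformInteger n₀) [LocallyOfFiniteType f] (c : Chart f)
    (hc : genericPoint V ∈ c.W.1) :
    ∃ a : c.A, a ≠ 0 ∧ ∀ x ∈ ((φ.app c).image n₀).map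
        (levelUp p c.A c.R (RelCartierMap.mul_le_mul_succ e n₀)),
      ((1 : c.R) ⊗ₜ[c.A] toRoot p (e * (n₀ + 1)) a) * x ∈ (φ.app c).image (n₀ + 1) := by
  have hu : ⊤ ≤ perfectGenericPoint p V ⁻¹ᵁ c.W.1 := fun y _ => by
    change perfectGenericPoint p V y ∈ c.W.1
    rwa [perfectGenericPoint_apply]
  have h1 := hn₀ c hu (n₀ + 1) n₀.le_succ
  let : Algebra c.A (perfectFunctionField p V) :=
    (c.evalAt (perfectGenericPoint p V) hu).toAlgebra
  have : Nonempty c.W.1 := ⟨⟨_, hc⟩⟩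
  have : IsDomain c.A := inferInstanceAs (IsDomain Γ(V, c.W.1))
  have : IsNoetherianRing c.A := IsLocallyNoetherian.component_noetherian c.W
  have : Algebra.FiniteType c.A c.R := f.finiteType_appLE c.W.2 c.U.2 c.le
  exact RelCartierMap.exists_mul_mem_of_isStableAt_baseChange
    (c.evalAt_injective _ hu perfectGenericPoint_apply)
    ((RelCartierMap.isStableAt_iff_toAbsolute _ n₀).2 h1)

theorem isUnit_funRes_of_le_basicOpen {W W' : V.Opens} (a : Γ(V, W)) (h : W' ≤ W)
    (h' : W' ≤ V.basicOpen a) : IsUnit (funRes h a) := by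
  have h1 : IsUnit (funRes (V.basicOpen_le a) a) :=
    RingedSpace.isUnit_res_basicOpen V.toRingedSpace a
  have h2 := h1.map (funRes h')
  rwa [funRes_funRes] at h2

theorem resA_bijective {f : X ⟶ V} {c' c : Chart f} (h : c'.W = c.W) :
    Function.Bijective (Chart.resA (le_of_eq (congrArg Subtype.val h)) : c.A →+* c'.A) := by
  obtain ⟨U', W', le'⟩ := c'
  obtain ⟨U, W, le⟩ := c
  dsimp only at h
  subst h
  have h1 : ∀ a : Γ(V, W'.1), (V.presheaf.map (𝟙 (Opposite.op W'.1))).hom a = a := fun a => by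
    rw [V.presheaf.map_id]
    rfl
  exact ⟨fun a b hab => (h1 a).symm.trans (Eq.trans hab (h1 b)), fun a => ⟨a, h1 a⟩⟩

/-- The images of the iterates are stable from the uniform integer on over a dense open subset of
any affine open set of the base. -/
theorem IsUniformInteger.exists_isStableAt {φ : RelSheafCartierMap p e f L} {n₀ : ℕ}
    (hn₀ : φ.IsUniformInteger n₀) [LocallyOfFiniteType f] [QuasiCompact f] (hL : IsLineBundle L)
    (W₀ : V.affineOpens) (hW₀ : genericPoint V ∈ W₀.1) :
    ∃ U : V.Opens, U ≤ W₀.1 ∧ Dense (U : Set V) ∧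
      ∀ c : Chart f, c.W.1 ≤ U → (φ.app c).IsStableAt n₀ := by
  have h1 : ∀ x ∈ f ⁻¹ᵁ W₀.1, ∃ O : X.affineOpens, x ∈ O.1 ∧ O.1 ≤ f ⁻¹ᵁ W₀.1 := fun x hx => by
    obtain ⟨_, ⟨O, hO, rfl⟩, hxO, hO'⟩ :=
      X.isBasis_affineOpens.exists_subset_of_mem_open hx (f ⁻¹ᵁ W₀.1).2
    exact ⟨⟨O, hO⟩, hxO, hO'⟩
  choose O hxO hO using h1
  obtain ⟨t, ht⟩ := (f.isCompact_preimage W₀.2.isCompact).elim_nhds_subcover'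
    (fun x hx => ((O x hx).1 : Set X)) (fun x hx => (O x hx).1.2.mem_nhds (hxO x hx))
  let c₀ : (f ⁻¹ᵁ W₀.1 : Set X) → Chart f := fun x => ⟨O x.1 x.2, W₀, hO x.1 x.2⟩
  choose a ha h2 using fun x => hn₀.exists_mul_mem (c₀ x) hW₀
  let a' : (f ⁻¹ᵁ W₀.1 : Set X) → Γ(V, W₀.1) := a
  -- On D(b) the defects of all charts of the finite cover are invertible at once.
  let b : Γ(V, W₀.1) := ∏ x ∈ t, a' x
  have hb : b ≠ 0 := by
    have : Nonempty W₀.1 := ⟨⟨_, hW₀⟩⟩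
    exact Finset.prod_ne_zero_iff.2 fun x _ => ha x
  refine ⟨V.basicOpen b, V.basicOpen_le b, ?_, fun c hc => ?_⟩
  · refine (V.basicOpen b).2.dense ((Opens.ne_bot_iff_nonempty _).1 fun h => hb ?_)
    exact (basicOpen_eq_bot_iff _).1 h
  refine RelCartierMap.isStableAt_of_forall_exists_pow
    {r | ∀ x ∈ ((φ.app c).image n₀).map (levelUp p c.A c.R (RelCartierMap.mul_le_mul_succ e n₀)),
      ∃ N : ℕ, r ^ N • x ∈ (φ.app c).image (n₀ + 1)} ?_ (fun r hr => hr)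
  refine (c.U.2.self_le_iSup_basicOpen_iff).1 fun y hy => Opens.mem_iSup.2 ?_
  have hy₀ : y ∈ (f ⁻¹ᵁ W₀.1 : Set X) := V.basicOpen_le b (hc (c.le hy))
  obtain ⟨x, hx, hyx⟩ := Set.mem_iUnion₂.1 (ht hy₀)
  -- Near y, choose an open set that is basic both in the given chart and in a chart of the cover.
  obtain ⟨r, r₀, hr, hyr⟩ := exists_basicOpen_le_affine_inter c.U.2 (O x.1 x.2).2 y ⟨hy, hyx⟩
  -- The base stays that of c. From the chart of the cover, stability passes to c' since the defect
  -- is a unit there; from c' it returns to c up to powers of r, since c' localizes only R.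
  let c' : Chart f := ⟨⟨X.basicOpen r, c.U.2.basicOpen r⟩, c.W, (X.basicOpen_le r).trans c.le⟩
  have hU' : c'.U.1 ≤ c.U.1 := X.basicOpen_le r
  have hU₀ : c'.U.1 ≤ (c₀ x).U.1 := hr.trans_le (X.basicOpen_le r₀)
  have hW₀' : c'.W.1 ≤ (c₀ x).W.1 := hc.trans (V.basicOpen_le b)
  have hunit : IsUnit (Chart.resA hW₀' (a x)) := by
    refine isUnit_funRes_of_le_basicOpen (a' x) _ (hc.trans ?_)
    obtain ⟨d, hd⟩ := Finset.dvd_prod_of_mem a' hx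
    rw [show b = _ from hd, V.basicOpen_mul]
    exact inf_le_left
  have h3 : (φ.app c').IsStableAt n₀ :=
    (φ.isGeneratingMap_res hL hU₀ hW₀' r₀ hr.symm).isStableAt_of_isUnit hunit (h2 x)
  refine ⟨⟨r, fun z hz => ?_⟩, hyr⟩
  exact (φ.isGeneratingMap_res hL hU' le_rfl r rfl).exists_pow_smul_mem
    (resA_bijective rfl) r (isLocalization_funRes c.U.2 r rfl hU') h3 hz

end RelSheafCartierMap

end RelFrob

end

/-! ### The theorem. -/

open RelFrob in
theorem mainTheorem5 (p : ℕ) [Fact p.Prime] (e : ℕ) (he : 0 < e)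
    {X V : Scheme.{u}} [IsIntegral V] [IsNoetherian V] [SchemeCharP p V]
    (hfin : IsFFinite p V) (hpure : IsFPure p V)
    (f : X ⟶ V) [LocallyOfFiniteType f] [QuasiCompact f]
    (L : X.Modules) (hL : IsLineBundle L) (φ : RelSheafCartierMap p e f L)
    (M : V.Modules) (hM : IsLineBundle M) (Ψ : SheafCartierMap p e V M) (hΨ : Ψ.Generates)
    (n₀ : ℕ) (hn₀ : φ.IsUniformInteger n₀) (n : ℕ) (hn : n₀ < n) :
    ∃ U : V.Opens, Dense (U : Set V) ∧
      (∀ c : Chart f, c.W.1 ≤ U → φ.sigmaGamma Ψ n c = φ.sigmaN n c) ∧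
      ∀ (K : Type u) [Field K] [PerfectField K] [CharP K p] (u : Spec (.of K) ⟶ V)
        (c : Chart f) (_ : c.W.1 ≤ U) (hu : ⊤ ≤ u ⁻¹ᵁ c.W.1),
        letI : Algebra c.A K := (c.evalAt u hu).toAlgebra
        (φ.sigmaGamma Ψ n c).map (baseRingMap p (e * n) c.A c.R K) =
            ((φ.app c).baseChange K).image n ∧
          ((φ.app c).baseChange K).image n =
            ((φ.app c).fiberMap K).sigma.map
              (algebraMap (K ⊗[c.A] c.R) ((K ⊗[c.A] c.R) ⊗[K] Root p (e * n) K)) := by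
  -- The open set U is sought inside W₀ so that restrictions of m still satisfy Ψ(m) = 1 on every
  -- chart over U.
  obtain ⟨W₀, hW₀, m, hm⟩ := hΨ.exists_eq_one hpure hM
  obtain ⟨U, hUW, hdense, hU⟩ := hn₀.exists_isStableAt hL W₀ hW₀
  have hstable : ∀ c : Chart f, c.W.1 ≤ U → (φ.app c).IsStableAt n := fun c hc =>
    (hU c hc).of_le hn.le
  have hsigma : ∀ c : Chart f, c.W.1 ≤ U → φ.sigmaGamma Ψ n c = φ.sigmaN n c := fun c hc => by
    refine (φ.app c).sigma_gamma_eq (Ψ.onChart c) (hstable c hc)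
      (m := secRes M (hc.trans hUW) m) ?_
    refine (Ψ.app_res (hc.trans hUW) m).trans ?_
    rw [hm]
    exact map_one (funRes (hc.trans hUW))
  refine ⟨U, hdense, hsigma, fun K _ _ _ u c hc hu => ?_⟩
  let : Algebra c.A K := (c.evalAt u hu).toAlgebra
  refine ⟨?_, ?_⟩
  · rw [hsigma c hc]
    exact ((φ.app c).image_baseChange K n).symm
  -- Stability on the chart is inherited by the fibre at any perfect point, with the same n.
  · exact (RelCartierMap.map_sigma_toAbsolute _
      ((RelCartierMap.isGeneratingMap_baseChange (φ.app c) K).isStableAt (hstable c hc))).symm
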